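/- For $\operatorname{Im}\tau>0$ put $q^a=e^{i\pi\tau a}$ and let $\Theta_1(u|\tau)=2\sum_{n\ge0}(-1)^nq^{(n+1/2)^2}\sin(2n+1)u$, $\Theta_2(u|\tau)=2\sum_{n\ge0}q^{(n+1/2)^2}\cos(2n+1)u$, $\Theta_3(u|\tau)=1+2\sum_{n\ge1}q^{n^2}\cos 2nu$, $\Theta_4(u|\tau)=1+2\sum_{n\ge1}(-1)^nq^{n^2}\cos 2nu$. Let $k(\tau)=\Theta_2(0|\tau)^2/\Theta_3(0|\tau)^2$ be the modulus and $k'(\tau)=\Theta_4(0|\tau)^2/\Theta_3(0|\tau)^2$ the complementary modulus. With $u=z/\Theta_3(0|\tau)^2$ put $$\mathrm{sn}(z|\tau)=\frac{\Theta_3(0|\tau)\Theta_1(u|\tau)}{\Theta_2(0|\tau)\Theta_4(u|\tau)},\quad \mathrm{cn}(z|\tau)=\frac{\Theta_4(0|\tau)\Theta_2(u|\tau)}{\Theta_2(0|\tau)\Theta_4(u|\tau)},\quad \mathrm{dn}(z|\tau)=\frac{\Theta_4(0|\tau)\Theta_3(u|\tau)}{\Theta_3(0|\tau)\Theta_4(u|\tau)}.$$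 For a number $k$ of the form $k(\tau)$ write $\mathrm{sn}(z;k)=\mathrm{sn}(z|\tau)$, etc., for a choice of $\tau$ with $k(\tau)=k$, and let $\mathrm{ns}=1/\mathrm{sn}$, $\mathrm{nc}=1/\mathrm{cn}$, $\mathrm{nd}=1/\mathrm{dn}$, $\mathrm{sc}=\mathrm{sn}/\mathrm{cn}$, $\mathrm{sd}=\mathrm{sn}/\mathrm{dn}$, $\mathrm{cd}=\mathrm{cn}/\mathrm{dn}$, $\mathrm{cs}=\mathrm{cn}/\mathrm{sn}$, $\mathrm{ds}=\mathrm{dn}/\mathrm{sn}$, $\mathrm{dc}=\mathrm{dn}/\mathrm{cn}$, as meromorphic functions on $\mathbb C$. The normalized Cayley–Klein (CK) algebra with curvatures $(\kappa_1,\kappa_2)$ is given by $[J,P_1]=P_2$, $[J,P_2]=-\kappa_2P_1$, $[P_1,P_2]=\kappa_1J$; it is elliptic, hyperbolic, co-hyperbolic, doubly hyperbolic for $(\kappa_1,\kappa_2)=(1,1),(-1,1),(1,-1),(-1,-1)$ respectively. A (Witt) realization consists of three vector fields $f\frac{d}{dz}$ on $\mathbb C$ with meromorphic coefficients, linearly independent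 over $\mathbb C$, that satisfy these relations for the bracket $[f\frac d{dz},g\frac d{dz}]=(fg'-gf')\frac d{dz}$. **Claim.** (0) The functions $\mathrm{sn}(\cdot|\tau),\mathrm{cn}(\cdot|\tau),\mathrm{dn}(\cdot|\tau)$ depend on $\tau$ only through $k(\tau)$. For every $k\in(0,1)$ there is $t>0$ with $k(it)=k$ and $k'(it)=\sqrt{1-k^2}$. (1) Let $\operatorname{Im}\tau>0$, $k=k(\tau)$, $k'=k'(\tau)$. Then $k(-1/\tau)=k'$, $k'(-1/\tau)=k$ and, with $\zeta=iz$, as meromorphic functions of $z$, $$\begin{array}{lll} \mathrm{sc}(z;k')=-i\,\mathrm{sn}(\zeta;k), & \mathrm{nc}(z;k')=\mathrm{cn}(\zeta;k), & \mathrm{dc}(z;k')=\mathrm{dn}(\zeta;k),\\ \mathrm{cs}(z;k')=i\,\mathrm{ns}(\zeta;k), & \mathrm{ds}(z;k')=i\,\mathrm{ds}(\zeta;k), & \mathrm{ns}(z;k')=i\,\mathrm{cs}(\zeta;k),\\ \mathrm{nd}(z;k')=\mathrm{cd}(\zeta;k), & \mathrm{cd}(z;k')=\mathrm{nd}(\zeta;k),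 & \mathrm{sd}(z;k')=-i\,\mathrm{sd}(\zeta;k),\\ \mathrm{cn}(z;k')=\mathrm{nc}(\zeta;k), & \mathrm{sn}(z;k')=-i\,\mathrm{sc}(\zeta;k), & \mathrm{dn}(z;k')=\mathrm{dc}(\zeta;k). \end{array}$$ (2) In the same situation $k^2+k'^2=1$, $k,k'\ne0$, and with $\lambda=ik/k'$ one has $k(\tau+1)=\lambda$, $k'(\tau+1)=1/k'$ and $$\mathrm{sd}(z;k)=\tfrac1{k'}\mathrm{sn}(k'z;\lambda),\quad \mathrm{cd}(z;k)=\mathrm{cn}(k'z;\lambda),\quad \mathrm{nd}(z;k)=\mathrm{dn}(k'z;\lambda).$$ (3) Let $0<k<1$ and $k'=\sqrt{1-k^2}$. The following triples of coefficients $(J,P_1,P_2)$, in which all functions are taken at $(z;k')$, give realizations of the elliptic (E), hyperbolic (H), co-hyperbolic (C) and doubly hyperbolic (D) algebra: * E: $(-\frac{\mathrm{dn}}{k},\frac{i\,\mathrm{cn}}{k},i\,\mathrm{sn})$; H: $(-\frac{\mathrm{dn}}{k},\frac{\mathrm{cn}}{k},\mathrm{sn})$; C: $(\frac{\mathrm{cn}}{k},\frac{\mathrm{dn}}{k},\mathrm{sn})$;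 D: $(\mathrm{sn},-\frac{i\,\mathrm{dn}}{k},\frac{i\,\mathrm{cn}}{k})$. * E: $(\frac{i\,\mathrm{dc}}{k'},\frac{\mathrm{nc}}{k'},i\,\mathrm{sc})$; H: $(\frac{i\,\mathrm{dc}}{k'},-\mathrm{sc},-\frac{i\,\mathrm{nc}}{k'})$; C: $(\frac{\mathrm{dc}}{k'},\frac{\mathrm{nc}}{k'},\mathrm{sc})$; D: $(\frac{\mathrm{dc}}{k'},\frac{i\,\mathrm{nc}}{k'},i\,\mathrm{sc})$. * E: $(\frac{i\,\mathrm{ns}}{k'},\frac{i\,\mathrm{cs}}{k},\frac{\mathrm{ds}}{kk'})$; H: $(\frac{\mathrm{ds}}{kk'},\frac{\mathrm{ns}}{k'},\frac{\mathrm{cs}}{k})$; C: $(\frac{\mathrm{cs}}{k},\frac{\mathrm{ds}}{kk'},\frac{\mathrm{ns}}{k'})$; D: $(\frac{\mathrm{ns}}{k'},\frac{\mathrm{cs}}{k},-\frac{\mathrm{ds}}{kk'})$. * E: $(-\mathrm{nd},i\,\mathrm{cd},i\,\mathrm{sd})$; H: $(\mathrm{nd},\mathrm{sd},\mathrm{cd})$;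 C: $(i\,\mathrm{nd},i\,\mathrm{sd},-\mathrm{cd})$; D: $(\mathrm{sd},-i\,\mathrm{nd},i\,\mathrm{cd})$. They remain realizations when they are written in the coordinate $\zeta=iz$, where by (1) they are expressed through Jacobi functions of modulus $k$; for instance the elliptic triple of the second family becomes $\{-\frac1{k'}\mathrm{dn}(\zeta;k)\frac{d}{d\zeta},\ \frac{i}{k'}\mathrm{cn}(\zeta;k)\frac{d}{d\zeta},\ i\,\mathrm{sn}(\zeta;k)\frac{d}{d\zeta}\}$. (4) Let $0<k<1$, $k'=\sqrt{1-k^2}$, $\lambda=ik/k'$. Written in the coordinate $u=k'z$, the triples of the last family in (3) with modulus $k$ instead of $k'$ become, with all functions at $(u;\lambda)$, E: $(-k'\mathrm{dn},ik'\mathrm{cn},i\,\mathrm{sn})$; H: $(k'\mathrm{dn},\mathrm{sn},k'\mathrm{cn})$; C: $(ik'\mathrm{dn},i\,\mathrm{sn},-k'\mathrm{cn})$; D: $(\mathrm{sn},-ik'\mathrm{dn},ik'\mathrm{cn})$, and these are realizations of the four CK-algebras. As $k$ runs through $(0,1)$, $|\lambda|$ takes exactly the values in $(0,\infty)$. -/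

import Mathlib

open Complex

noncomputable section

namespace JacobiElliptic

/-- The power `q ^ a` of the nome `q = exp (iπτ)`, with the branch `exp (iπτa)`. -/
def nomePow (τ a : ℂ) : ℂ := Complex.exp (Real.pi * I * τ * a)

/-- The theta function `Θ₁(u|τ) = 2 ∑_{n ≥ 0} (-1)ⁿ q^((n+1/2)²) sin((2n+1)u)`. -/
def theta1 (u τ : ℂ) : ℂ :=
  2 * ∑' n : ℕ, (-1) ^ n * nomePow τ (((n : ℂ) + 1 / 2) ^ 2) * Complex.sin ((2 * (n : ℂ) + 1) * u)

/-- The theta function `Θ₂(u|τ) = 2 ∑_{n ≥ 0} q^((n+1/2)²) cos((2n+1)u)`. -/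
def theta2 (u τ : ℂ) : ℂ :=
  2 * ∑' n : ℕ, nomePow τ (((n : ℂ) + 1 / 2) ^ 2) * Complex.cos ((2 * (n : ℂ) + 1) * u)

/-- The theta function `Θ₃(u|τ) = 1 + 2 ∑_{n ≥ 1} q^(n²) cos(2nu)`. -/
def theta3 (u τ : ℂ) : ℂ :=
  1 + 2 * ∑' n : ℕ, nomePow τ (((n : ℂ) + 1) ^ 2) * Complex.cos (2 * ((n : ℂ) + 1) * u)

/-- The theta function `Θ₄(u|τ) = 1 + 2 ∑_{n ≥ 1} (-1)ⁿ q^(n²) cos(2nu)`. -/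
def theta4 (u τ : ℂ) : ℂ :=
  1 + 2 * ∑' n : ℕ,
    (-1) ^ (n + 1) * nomePow τ (((n : ℂ) + 1) ^ 2) * Complex.cos (2 * ((n : ℂ) + 1) * u)

/-- The modulus `k = Θ₂(0|τ)² / Θ₃(0|τ)²`. -/
def modulus (τ : ℂ) : ℂ := theta2 0 τ ^ 2 / theta3 0 τ ^ 2

/-- The complementary modulus `k' = Θ₄(0|τ)² / Θ₃(0|τ)²`. -/
def comodulus (τ : ℂ) : ℂ := theta4 0 τ ^ 2 / theta3 0 τ ^ 2

/-- The meromorphic function on `ℂ` given by an expression that is meromorphic: removable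
singularities are filled in and the value at a pole is `0`. Two functions of this form that agree
off a discrete set are equal. -/
def regularize (f : ℂ → ℂ) : ℂ → ℂ := toMeromorphicNFOn f Set.univ

/-- `sn(z|τ)`; the theta functions are taken at `u = z / Θ₃(0|τ)²`. -/
def snTau (τ : ℂ) : ℂ → ℂ := regularize fun z =>
  theta3 0 τ / theta2 0 τ * (theta1 (z / theta3 0 τ ^ 2) τ / theta4 (z / theta3 0 τ ^ 2) τ)

/-- `cn(z|τ)`. -/
def cnTau (τ : ℂ) : ℂ → ℂ := regularize fun z =>
  theta4 0 τ / theta2 0 τ * (theta2 (z / theta3 0 τ ^ 2) τ / theta4 (z / theta3 0 τ ^ 2) τ)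

/-- `dn(z|τ)`. -/
def dnTau (τ : ℂ) : ℂ → ℂ := regularize fun z =>
  theta4 0 τ / theta3 0 τ * (theta3 (z / theta3 0 τ ^ 2) τ / theta4 (z / theta3 0 τ ^ 2) τ)

/-- A point `τ` of the upper half-plane whose modulus is `k` (arbitrary if there is none). -/
def tauOf (k : ℂ) : ℂ := Classical.epsilon fun τ : ℂ => 0 < τ.im ∧ modulus τ = k

/-! The Jacobi functions of modulus `k`, and their reciprocals and quotients. -/

/-- `sn(z; k)`. -/
def sn (k : ℂ) : ℂ → ℂ := snTau (tauOf k)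

/-- `cn(z; k)`. -/
def cn (k : ℂ) : ℂ → ℂ := cnTau (tauOf k)

/-- `dn(z; k)`. -/
def dn (k : ℂ) : ℂ → ℂ := dnTau (tauOf k)

def ns (k : ℂ) : ℂ → ℂ := regularize fun z => 1 / sn k z
def nc (k : ℂ) : ℂ → ℂ := regularize fun z => 1 / cn k z
def nd (k : ℂ) : ℂ → ℂ := regularize fun z => 1 / dn k z
def sc (k : ℂ) : ℂ → ℂ := regularize fun z => sn k z / cn k z
def sd (k : ℂ) : ℂ → ℂ := regularize fun z => sn k z / dn k z
def cd (k : ℂ) : ℂ → ℂ := regularize fun z => cn k z / dn k z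
def cs (k : ℂ) : ℂ → ℂ := regularize fun z => cn k z / sn k z
def ds (k : ℂ) : ℂ → ℂ := regularize fun z => dn k z / sn k z
def dc (k : ℂ) : ℂ → ℂ := regularize fun z => dn k z / cn k z

/-! Cayley-Klein algebras and their realizations by meromorphic vector fields. -/

/-- The four normalized Cayley-Klein algebras with non-vanishing curvatures. -/
inductive CKType where
  | elliptic
  | hyperbolic
  | coHyperbolic
  | doublyHyperbolic

/-- The curvature `κ₁`. -/
def CKType.curv1 : CKType → ℂ
  | .elliptic => 1
  | .hyperbolic => -1
  | .coHyperbolic => 1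
  | .doublyHyperbolic => -1

/-- The curvature `κ₂`. -/
def CKType.curv2 : CKType → ℂ
  | .elliptic => 1
  | .hyperbolic => 1
  | .coHyperbolic => -1
  | .doublyHyperbolic => -1

/-- The coefficient functions of three vector fields `J d/dz`, `P₁ d/dz`, `P₂ d/dz`. -/
structure Generators where
  J : ℂ → ℂ
  P₁ : ℂ → ℂ
  P₂ : ℂ → ℂ

/-- The coefficient `f g' - g f'` of the commutator `[f d/dz, g d/dz]`. -/
def wittBracket (f g : ℂ → ℂ) : ℂ → ℂ := fun z => f z * deriv g z - g z * deriv f z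

/-- The vector fields are meromorphic on `ℂ`, linearly independent over `ℂ`, and satisfy
`[J, P₁] = P₂`, `[J, P₂] = -κ₂ P₁`, `[P₁, P₂] = κ₁ J`. As usual, meromorphic functions are equal
when they agree off a (closed) discrete set. -/
structure IsWittRealization (T : CKType) (G : Generators) : Prop where
  meromorphic_J : Meromorphic G.J
  meromorphic_P₁ : Meromorphic G.P₁
  meromorphic_P₂ : Meromorphic G.P₂
  bracket_J_P₁ : wittBracket G.J G.P₁ =ᶠ[Filter.codiscrete ℂ] G.P₂
  bracket_J_P₂ : wittBracket G.J G.P₂ =ᶠ[Filter.codiscrete ℂ] fun z => -T.curv2 * G.P₁ z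
  bracket_P₁_P₂ : wittBracket G.P₁ G.P₂ =ᶠ[Filter.codiscrete ℂ] fun z => T.curv1 * G.J z
  independent : ∀ a b c : ℂ,
    (fun z => a * G.J z + b * G.P₁ z + c * G.P₂ z) =ᶠ[Filter.codiscrete ℂ] (fun _ => 0) →
      a = 0 ∧ b = 0 ∧ c = 0

/-- The same vector fields in the coordinate `u = c z`: since `d/dz = c d/du`, the coefficient
`f` becomes `u ↦ c f(u / c)`. -/
def Generators.changeVar (c : ℂ) (G : Generators) : Generators where
  J := fun u => c * G.J (u / c)
  P₁ := fun u => c * G.P₁ (u / c)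
  P₂ := fun u => c * G.P₂ (u / c)

/-! In the next four families `k` is the modulus and `k'` the complementary modulus. -/

def basicFamily (k k' : ℂ) : CKType → Generators
  | .elliptic => ⟨fun z => -dn k z / k', fun z => I * cn k z / k', fun z => I * sn k z⟩
  | .hyperbolic => ⟨fun z => -dn k z / k', fun z => cn k z / k', fun z => sn k z⟩
  | .coHyperbolic => ⟨fun z => cn k z / k', fun z => dn k z / k', fun z => sn k z⟩
  | .doublyHyperbolic => ⟨fun z => sn k z, fun z => -I * dn k z / k', fun z => I * cn k z / k'⟩

def cFamily (k : ℂ) : CKType → Generators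
  | .elliptic => ⟨fun z => I * dc k z / k, fun z => nc k z / k, fun z => I * sc k z⟩
  | .hyperbolic => ⟨fun z => I * dc k z / k, fun z => -sc k z, fun z => -I * nc k z / k⟩
  | .coHyperbolic => ⟨fun z => dc k z / k, fun z => nc k z / k, fun z => sc k z⟩
  | .doublyHyperbolic => ⟨fun z => dc k z / k, fun z => I * nc k z / k, fun z => I * sc k z⟩

def sFamily (k k' : ℂ) : CKType → Generators
  | .elliptic => ⟨fun z => I * ns k z / k, fun z => I * cs k z / k', fun z => ds k z / (k * k')⟩
  | .hyperbolic => ⟨fun z => ds k z / (k * k'), fun z => ns k z / k, fun z => cs k z / k'⟩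
  | .coHyperbolic => ⟨fun z => cs k z / k', fun z => ds k z / (k * k'), fun z => ns k z / k⟩
  | .doublyHyperbolic =>
      ⟨fun z => ns k z / k, fun z => cs k z / k', fun z => -ds k z / (k * k')⟩

def dFamily (k : ℂ) : CKType → Generators
  | .elliptic => ⟨fun z => -nd k z, fun z => I * cd k z, fun z => I * sd k z⟩
  | .hyperbolic => ⟨fun z => nd k z, fun z => sd k z, fun z => cd k z⟩
  | .coHyperbolic => ⟨fun z => I * nd k z, fun z => I * sd k z, fun z => -cd k z⟩
  | .doublyHyperbolic => ⟨fun z => sd k z, fun z => -I * nd k z, fun z => I * cd k z⟩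

/-- Vector fields built from the Jacobi functions of modulus `l`. -/
def lambdaFamily (l k' : ℂ) : CKType → Generators
  | .elliptic => ⟨fun u => -k' * dn l u, fun u => I * k' * cn l u, fun u => I * sn l u⟩
  | .hyperbolic => ⟨fun u => k' * dn l u, fun u => sn l u, fun u => k' * cn l u⟩
  | .coHyperbolic => ⟨fun u => I * k' * dn l u, fun u => I * sn l u, fun u => -k' * cn l u⟩
  | .doublyHyperbolic => ⟨fun u => sn l u, fun u => -I * k' * dn l u, fun u => I * k' * cn l u⟩

end JacobiElliptic

end

open JacobiElliptic

namespace JacobiElliptic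

open scoped Real

/-! ### The theta functions as bilateral series -/

/-! The theorem is reduced to one differential system. The quotients `sn`, `cn`, `dn` satisfy
$s'=cd$, $c'=-sd$, $d'=-k^2sc$, $s^2+c^2=1$, $d^2+k^2s^2=1$ with initial values $0,1,1$
(`jacobiTriple_theta`). Only $k^2$ enters, so uniqueness of solutions together with the identity
theorem (`JacobiTriple.eventuallyEq`) shows independence of the choice of $\tau$. It also reduces
the transformation formulas to algebra: the quotients on one side solve the system of the other side
(`JacobiTriple.imaginary`, `JacobiTriple.translate`). Only theta constants have to be transformed
under $\tau\mapsto-1/\tau$ and $\tau\mapsto\tau+1$.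

The system itself comes from doubling formulas relating theta functions of periods $\tau$ and
$2\tau$, all special cases of `jacobiTheta₂_mul_jacobiTheta₂`. They give the quadratic relations
and, after differentiation, the Wronskian of $\Theta_1,\Theta_4$. Its constant is Jacobi's formula
$\Theta_1'(0)=\Theta_2\Theta_3\Theta_4(0)$: the ratio of the two sides is invariant under
$\tau\mapsto2\tau$ and tends to $1$ at the cusp. The same passage to the cusp shows that the theta
constants do not vanish.

The system makes each of the four families of Jacobi functions a triple with $[X,Y]=aZ$, $[Y,Z]=bX$,
$[Z,X]=cY$. Realizing a Cayley–Klein algebra is then a matter of ordering and rescaling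
(`BracketTriple.isWittRealization`), and linear independence follows from the brackets. That every
$k\in(0,1)$ occurs is the intermediate value theorem on the imaginary axis. -/

theorem theta3_eq {τ : ℂ} (hτ : 0 < τ.im) (u : ℂ) :
    theta3 u τ = jacobiTheta₂ (u / π) τ := by
  have hπ : (π : ℂ) ≠ 0 := by exact_mod_cast Real.pi_ne_zero
  have hs := (summable_jacobiTheta₂_term_iff (u / π) τ).mpr hτ
  have h : Summable fun n : ℕ => jacobiTheta₂_term (n : ℤ) (u / π) τ :=
    hs.comp_injective Nat.cast_injective
  have h' : Summable fun n : ℕ => jacobiTheta₂_term (-(n + 1 : ℤ)) (u / π) τ :=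
    hs.comp_injective (i := fun n : ℕ => (-(n + 1 : ℤ))) (fun a b h => by simpa using h)
  have ht (n : ℕ) : jacobiTheta₂_term ((n + 1 : ℕ) : ℤ) (u / π) τ +
      jacobiTheta₂_term (-(n + 1 : ℤ)) (u / π) τ =
      2 * (nomePow τ (((n : ℂ) + 1) ^ 2) * Complex.cos (2 * ((n : ℂ) + 1) * u)) := by
    have e1 : 2 * π * I * ((n + 1 : ℕ) : ℤ) * (u / π) + π * I * ((n + 1 : ℕ) : ℤ) ^ 2 * τ =
        π * I * τ * (n + 1) ^ 2 + 2 * (n + 1) * u * I := by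
      push_cast; field_simp; ring
    have e2 : 2 * π * I * (-(n + 1 : ℤ) : ℤ) * (u / π) + π * I * (-(n + 1 : ℤ) : ℤ) ^ 2 * τ =
        π * I * τ * (n + 1) ^ 2 + -(2 * (n + 1) * u) * I := by
      push_cast; field_simp; ring
    rw [jacobiTheta₂_term, jacobiTheta₂_term, e1, e2, exp_add, exp_add, Complex.cos, nomePow]
    ring
  have hT : HasSum (fun n : ℤ => jacobiTheta₂_term n (u / π) τ) _ :=
    HasSum.of_nat_of_neg_add_one h.hasSum h'.hasSum
  -- The term $n=0$ is split off, so that $n+1$ is paired with $-(n+1)$.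
  rw [jacobiTheta₂, hT.tsum_eq, h.tsum_eq_zero_add, add_assoc,
    ← ((summable_nat_add_iff 1).2 h).tsum_add h', theta3, ← tsum_mul_left]
  congr 1
  · simp [jacobiTheta₂_term]
  · exact tsum_congr fun n => (ht n).symm

/-- The shift of $u$ by $\pi/2$ multiplies $\cos 2nu$ by $(-1)^n$ and so turns $\Theta_3$ into
$\Theta_4$. -/
theorem theta4_eq {τ : ℂ} (hτ : 0 < τ.im) (u : ℂ) :
    theta4 u τ = jacobiTheta₂ (u / π + 1 / 2) τ := by
  have hπ : (π : ℂ) ≠ 0 := by exact_mod_cast Real.pi_ne_zero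
  rw [show u / π + 1 / 2 = (u + π / 2) / π by field_simp, ← theta3_eq hτ, theta3, theta4]
  congr 2
  refine tsum_congr fun n => ?_
  rw [show 2 * ((n : ℂ) + 1) * (u + π / 2) = 2 * (n + 1) * u + (n + 1 : ℕ) * π by
    push_cast; ring, Complex.cos_antiperiodic.add_nat_mul_eq]
  ring

/-- Completing the square: the prefactor turns the exponents at $n$ and $-(n+1)$ into the same power
$q^{(n+1/2)^2}$ with opposite frequencies $\pm(2n+1)u$. -/
theorem theta2_eq {τ : ℂ} (hτ : 0 < τ.im) (u : ℂ) :
    theta2 u τ = exp (π * I * τ / 4 + I * u) * jacobiTheta₂ (u / π + τ / 2) τ := by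
  have hπ : (π : ℂ) ≠ 0 := by exact_mod_cast Real.pi_ne_zero
  have hs := (summable_jacobiTheta₂_term_iff (u / π + τ / 2) τ).mpr hτ
  have h : Summable fun n : ℕ => jacobiTheta₂_term (n : ℤ) (u / π + τ / 2) τ :=
    hs.comp_injective Nat.cast_injective
  have h' : Summable fun n : ℕ => jacobiTheta₂_term (-(n + 1 : ℤ)) (u / π + τ / 2) τ :=
    hs.comp_injective (i := fun n : ℕ => (-(n + 1 : ℤ))) (fun a b h => by simpa using h)
  have ht (n : ℕ) : exp (π * I * τ / 4 + I * u) * (jacobiTheta₂_term (n : ℤ) (u / π + τ / 2) τ +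
      jacobiTheta₂_term (-(n + 1 : ℤ)) (u / π + τ / 2) τ) =
      2 * (nomePow τ (((n : ℂ) + 1 / 2) ^ 2) * Complex.cos ((2 * (n : ℂ) + 1) * u)) := by
    have e1 : π * I * τ / 4 + I * u +
        (2 * π * I * (n : ℤ) * (u / π + τ / 2) + π * I * (n : ℤ) ^ 2 * τ) =
        π * I * τ * (n + 1 / 2) ^ 2 + (2 * n + 1) * u * I := by
      push_cast; field_simp; ring
    have e2 : π * I * τ / 4 + I * u + (2 * π * I * (-(n + 1 : ℤ) : ℤ) * (u / π + τ / 2) +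
        π * I * (-(n + 1 : ℤ) : ℤ) ^ 2 * τ) =
        π * I * τ * (n + 1 / 2) ^ 2 + -((2 * n + 1) * u) * I := by
      push_cast; field_simp; ring
    rw [jacobiTheta₂_term, jacobiTheta₂_term, mul_add, ← exp_add, ← exp_add, e1, e2, exp_add,
      exp_add, Complex.cos, nomePow]
    ring
  have hT : HasSum (fun n : ℤ => jacobiTheta₂_term n (u / π + τ / 2) τ) _ :=
    HasSum.of_nat_of_neg_add_one h.hasSum h'.hasSum
  rw [jacobiTheta₂, hT.tsum_eq, ← h.tsum_add h', theta2, ← tsum_mul_left, ← tsum_mul_left]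
  exact tsum_congr fun n => (ht n).symm

theorem theta1_eq_theta2 (u τ : ℂ) : theta1 u τ = theta2 (u - π / 2) τ := by
  rw [theta1, theta2]
  congr 1
  refine tsum_congr fun n => ?_
  rw [show (2 * (n : ℂ) + 1) * (u - π / 2) = ((2 * n + 1) * u - π / 2) - n * π by ring,
    Complex.cos_antiperiodic.sub_nat_mul_eq, Complex.cos_sub_pi_div_two]
  ring

theorem theta1_eq {τ : ℂ} (hτ : 0 < τ.im) (u : ℂ) :
    theta1 u τ = -I * (exp (π * I * τ / 4 + I * u) * jacobiTheta₂ (u / π + τ / 2 + 1 / 2) τ) := by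
  have hπ : (π : ℂ) ≠ 0 := by exact_mod_cast Real.pi_ne_zero
  rw [theta1_eq_theta2, theta2_eq hτ,
    show u / π + τ / 2 + 1 / 2 = (u - π / 2) / π + τ / 2 + 1 by field_simp; ring,
    jacobiTheta₂_add_left,
    show (π : ℂ) * I * τ / 4 + I * (u - π / 2) = (π * I * τ / 4 + I * u) + -(π / 2 * I) by ring,
    exp_add _ (-(π / 2 * I)), exp_neg, exp_pi_div_two_mul_I, inv_I]
  ring

theorem theta1_neg (u τ : ℂ) : theta1 (-u) τ = -theta1 u τ := by
  simp [theta1, tsum_neg]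

theorem theta2_neg (u τ : ℂ) : theta2 (-u) τ = theta2 u τ := by
  simp [theta2]

theorem theta1_zero (τ : ℂ) : theta1 0 τ = 0 := by
  simp [theta1]

/-! ### Doubling formulas -/

/-- In the double series, $2(a^2+b^2)=(a+b)^2+(a-b)^2$ and $a(z+w)+b(z-w)=(a+b)z+(a-b)w$, so the
left side is a sum over index pairs of equal parity. A shift by $1/2$ multiplies the $n$-th term by
$(-1)^n$; hence on the right, pairs of equal parity count twice and all others cancel. -/
theorem jacobiTheta₂_mul_jacobiTheta₂ {τ : ℂ} (hτ : 0 < τ.im) (z w : ℂ) :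
    2 * (jacobiTheta₂ (z + w) (2 * τ) * jacobiTheta₂ (z - w) (2 * τ)) =
      jacobiTheta₂ z τ * jacobiTheta₂ w τ +
        jacobiTheta₂ (z + 1 / 2) τ * jacobiTheta₂ (w + 1 / 2) τ := by
  have hτ2 : 0 < (2 * τ).im := by simpa using hτ
  have hs (z : ℂ) {τ : ℂ} (hτ : 0 < τ.im) : Summable (fun n => ‖jacobiTheta₂_term n z τ‖) :=
    ((summable_jacobiTheta₂_term_iff z τ).mpr hτ).norm
  have hmul (z w : ℂ) {τ : ℂ} (hτ : 0 < τ.im) : HasSum (fun p : ℤ × ℤ =>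
      jacobiTheta₂_term p.1 z τ * jacobiTheta₂_term p.2 w τ)
        (jacobiTheta₂ z τ * jacobiTheta₂ w τ) := by
    rw [jacobiTheta₂, jacobiTheta₂, tsum_mul_tsum_of_summable_norm (hs z hτ) (hs w hτ)]
    exact (summable_mul_of_summable_norm (hs z hτ) (hs w hτ)).hasSum
  set φ : ℤ × ℤ → ℤ × ℤ := fun p => (p.1 + p.2, p.1 - p.2) with hφ
  have hφi : Function.Injective φ := by
    rintro ⟨a, b⟩ ⟨c, d⟩ h
    simp only [hφ, Prod.mk.injEq] at h ⊢
    omega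
  have hR := (hmul z w hτ).add (hmul (z + 1 / 2) (w + 1 / 2) hτ)
  have hhalf (n : ℤ) (z : ℂ) : jacobiTheta₂_term n (z + 1 / 2) τ =
      (-1) ^ n * jacobiTheta₂_term n z τ := by
    rw [jacobiTheta₂_term, jacobiTheta₂_term, ← exp_pi_mul_I, ← exp_int_mul, ← exp_add]
    congr 1
    ring
  rw [← hφi.hasSum_iff] at hR
  · refine ((hmul (z + w) (z - w) hτ2).mul_left 2).unique ?_
    convert! hR using 1
    funext p
    simp only [hφ, Function.comp, hhalf]
    have h1 : ((-1 : ℂ)) ^ (p.1 + p.2) * (-1) ^ (p.1 - p.2) = 1 := by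
      rw [← zpow_add₀ (by norm_num), show p.1 + p.2 + (p.1 - p.2) = 2 * p.1 by ring, zpow_mul]
      norm_num
    have h2 : jacobiTheta₂_term p.1 (z + w) (2 * τ) * jacobiTheta₂_term p.2 (z - w) (2 * τ) =
        jacobiTheta₂_term (p.1 + p.2) z τ * jacobiTheta₂_term (p.1 - p.2) w τ := by
      simp only [jacobiTheta₂_term, ← exp_add]
      congr 1
      push_cast
      ring
    rw [h2]
    linear_combination (-jacobiTheta₂_term (p.1 + p.2) z τ * jacobiTheta₂_term (p.1 - p.2) w τ) * h1
  -- A pair outside the range of `φ` has odd $a+b$, so its two contributions cancel.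
  · rintro ⟨a, b⟩ hab
    have hodd : Odd (a + b) := by
      by_contra h
      rw [Int.not_odd_iff_even] at h
      obtain ⟨c, hc⟩ := h
      refine hab ⟨(c, a - c), ?_⟩
      simp only [hφ, Prod.mk.injEq]
      omega
    simp only [hhalf]
    have : ((-1 : ℂ)) ^ a * (-1) ^ b = -1 := by
      rw [← zpow_add₀ (by norm_num), hodd.neg_one_zpow]
    linear_combination (jacobiTheta₂_term a z τ * jacobiTheta₂_term b w τ) * this

/-- This and the next four formulas are the product formula with $(z,w)$ shifted by $(0,0)$,
$(1/2,0)$, $(\tau,0)$, $(\tau/2,\tau/2)$ and $(\tau/2+1/2,\tau/2)$. A shift by $\tau$ is a half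
period for $2\tau$, which is how $\Theta_1,\Theta_2$ arise on the left. -/
theorem theta3_mul_theta3_two_mul {τ : ℂ} (hτ : 0 < τ.im) (x y : ℂ) :
    2 * (theta3 (x + y) (2 * τ) * theta3 (x - y) (2 * τ)) =
    theta3 x τ * theta3 y τ + theta4 x τ * theta4 y τ := by
  have hτ2 : 0 < (2 * τ).im := by simpa using hτ
  simp only [theta3_eq hτ2, theta3_eq hτ, theta4_eq hτ, add_div, sub_div,
    jacobiTheta₂_mul_jacobiTheta₂ hτ]

theorem theta4_mul_theta4_two_mul {τ : ℂ} (hτ : 0 < τ.im) (x y : ℂ) :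
    2 * (theta4 (x + y) (2 * τ) * theta4 (x - y) (2 * τ)) =
    theta4 x τ * theta3 y τ + theta3 x τ * theta4 y τ := by
  have hτ2 : 0 < (2 * τ).im := by simpa using hτ
  simp only [theta3_eq hτ, theta4_eq hτ, theta4_eq hτ2]
  have h := jacobiTheta₂_mul_jacobiTheta₂ hτ (x / π + 1 / 2) (y / π)
  rw [show x / (π : ℂ) + 1 / 2 + 1 / 2 = x / π + 1 by ring, jacobiTheta₂_add_left] at h
  rw [← h]
  ring_nf

theorem theta2_mul_theta2_two_mul {τ : ℂ} (hτ : 0 < τ.im) (x y : ℂ) :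
    2 * (theta2 (x + y) (2 * τ) * theta2 (x - y) (2 * τ)) =
    theta3 x τ * theta3 y τ - theta4 x τ * theta4 y τ := by
  have hτ2 : 0 < (2 * τ).im := by simpa using hτ
  have hπ : (π : ℂ) ≠ 0 := by exact_mod_cast Real.pi_ne_zero
  simp only [theta3_eq hτ, theta4_eq hτ, theta2_eq hτ2]
  have h := jacobiTheta₂_mul_jacobiTheta₂ hτ (x / π + τ) (y / π)
  rw [show x / (π : ℂ) + τ + 1 / 2 = x / π + 1 / 2 + τ by ring, jacobiTheta₂_add_left',
    jacobiTheta₂_add_left'] at h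
  have e1 : exp (π * I * (2 * τ) / 4 + I * (x + y)) * exp (π * I * (2 * τ) / 4 + I * (x - y)) =
      exp (π * I * (τ + 2 * (x / π))) := by
    rw [← exp_add]
    congr 1
    field_simp
    ring
  have e2 : exp (-π * I * (τ + 2 * (x / π))) = (exp (π * I * (τ + 2 * (x / π))))⁻¹ := by
    rw [← exp_neg]
    congr 1
    ring
  have e3 : exp (-π * I * (τ + 2 * (x / π + 1 / 2))) = -(exp (π * I * (τ + 2 * (x / π))))⁻¹ := by
    rw [← exp_neg, show -(π : ℂ) * I * (τ + 2 * (x / π + 1 / 2)) =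
      -(π * I * (τ + 2 * (x / π))) - π * I by ring, exp_sub, exp_pi_mul_I]
    ring
  rw [e2, e3] at h
  rw [show (x + y) / (π : ℂ) + 2 * τ / 2 = x / π + τ + y / π by ring,
    show (x - y) / (π : ℂ) + 2 * τ / 2 = x / π + τ - y / π by ring]
  have h0 := exp_ne_zero (π * I * (τ + 2 * (x / π)))
  rw [mul_mul_mul_comm, e1]
  set E := exp (π * I * (τ + 2 * (x / π)))
  rw [mul_left_comm, h]
  field_simp
  ring

theorem theta2_mul_theta3_two_mul {τ : ℂ} (hτ : 0 < τ.im) (x y : ℂ) :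
    2 * (theta2 (x + y) (2 * τ) * theta3 (x - y) (2 * τ)) =
    theta2 x τ * theta2 y τ - theta1 x τ * theta1 y τ := by
  have hτ2 : 0 < (2 * τ).im := by simpa using hτ
  simp only [theta1_eq hτ, theta2_eq hτ, theta3_eq hτ2, theta2_eq hτ2]
  have h := jacobiTheta₂_mul_jacobiTheta₂ hτ (x / π + τ / 2) (y / π + τ / 2)
  rw [show x / (π : ℂ) + τ / 2 + (y / π + τ / 2) = (x + y) / π + 2 * τ / 2 by ring,
    show x / (π : ℂ) + τ / 2 - (y / π + τ / 2) = (x - y) / π by ring] at h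
  have e1 : exp (π * I * (2 * τ) / 4 + I * (x + y)) =
      exp (π * I * τ / 4 + I * x) * exp (π * I * τ / 4 + I * y) := by
    rw [← exp_add]
    congr 1
    ring
  rw [e1]
  linear_combination (exp (π * I * τ / 4 + I * x) * exp (π * I * τ / 4 + I * y)) * h +
    (exp (π * I * τ / 4 + I * x) * exp (π * I * τ / 4 + I * y)) *
      (jacobiTheta₂ (x / π + τ / 2 + 1 / 2) τ * jacobiTheta₂ (y / π + τ / 2 + 1 / 2) τ) * I_sq

theorem theta1_mul_theta4_two_mul {τ : ℂ} (hτ : 0 < τ.im) (x y : ℂ) :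
    2 * (theta1 (x + y) (2 * τ) * theta4 (x - y) (2 * τ)) =
    theta1 x τ * theta2 y τ + theta2 x τ * theta1 y τ := by
  have hτ2 : 0 < (2 * τ).im := by simpa using hτ
  simp only [theta1_eq hτ, theta2_eq hτ, theta4_eq hτ2, theta1_eq hτ2]
  have h := jacobiTheta₂_mul_jacobiTheta₂ hτ (x / π + τ / 2 + 1 / 2) (y / π + τ / 2)
  rw [show x / (π : ℂ) + τ / 2 + 1 / 2 + (y / π + τ / 2) = (x + y) / π + 2 * τ / 2 + 1 / 2 by ring,
    show x / (π : ℂ) + τ / 2 + 1 / 2 - (y / π + τ / 2) = (x - y) / π + 1 / 2 by ring,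
    show x / (π : ℂ) + τ / 2 + 1 / 2 + 1 / 2 = x / π + τ / 2 + 1 by ring,
    jacobiTheta₂_add_left] at h
  have e1 : exp (π * I * (2 * τ) / 4 + I * (x + y)) =
      exp (π * I * τ / 4 + I * x) * exp (π * I * τ / 4 + I * y) := by
    rw [← exp_add]
    congr 1
    ring
  rw [e1]
  linear_combination (-I * exp (π * I * τ / 4 + I * x) * exp (π * I * τ / 4 + I * y)) * h

open Filter Topology

/-! ### Behaviour at the cusp -/

/-- Dominated convergence: for $\operatorname{Im}\tau\ge1$ the terms are bounded by their size at
$\operatorname{Im}\tau=1$, and only those with exponent $0$ survive at the cusp. -/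
theorem tendsto_tsum_nome {c : ℤ → ℂ} {p : ℤ → ℤ} (hp : ∀ n, 0 ≤ p n)
    (hs : Summable fun n => ‖c n‖ * Real.exp (-π * p n)) :
    Tendsto (fun τ : ℂ => ∑' n, c n * exp (π * I * p n * τ)) (comap Complex.im atTop)
      (𝓝 (∑' n, if p n = 0 then c n else 0)) := by
  have hnorm (n : ℤ) (τ : ℂ) : ‖exp (π * I * p n * τ)‖ = Real.exp (-π * p n * τ.im) := by
    rw [Complex.norm_exp, show (π : ℂ) * I * p n * τ = ((π * p n : ℝ) : ℂ) * (I * τ) by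
      push_cast; ring, re_ofReal_mul]
    simp
  refine tendsto_tsum_of_dominated_convergence hs (fun n => ?_) ?_
  · split_ifs with h
    · simpa [h] using tendsto_const_nhds
    · have hpos : (0 : ℝ) < p n := by
        exact_mod_cast lt_of_le_of_ne (hp n) (Ne.symm h)
      suffices Tendsto (fun τ : ℂ => exp (π * I * p n * τ)) (comap Complex.im atTop) (𝓝 0) by
        simpa using this.const_mul (c n)
      rw [tendsto_zero_iff_norm_tendsto_zero]
      simp only [hnorm]
      refine Real.tendsto_exp_atBot.comp ?_
      exact tendsto_comap.const_mul_atTop_of_neg (by nlinarith [Real.pi_pos])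
  · have h1 : ∀ᶠ τ : ℂ in comap Complex.im atTop, 1 ≤ τ.im :=
      tendsto_comap.eventually (eventually_ge_atTop 1)
    filter_upwards [h1] with τ hτ n
    rw [norm_mul, hnorm]
    refine mul_le_mul_of_nonneg_left (Real.exp_le_exp.2 ?_) (norm_nonneg _)
    have : 0 ≤ π * p n := mul_nonneg Real.pi_pos.le (by exact_mod_cast hp n)
    nlinarith

theorem eventually_im_pos : ∀ᶠ τ : ℂ in comap Complex.im atTop, 0 < τ.im :=
  tendsto_comap.eventually (eventually_gt_atTop 0)

theorem sq_add_self_nonneg (n : ℤ) : 0 ≤ n ^ 2 + n := by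
  rcases le_or_gt 0 n with h | h <;> nlinarith

theorem tsum_sq_ite (c : ℤ → ℂ) : (∑' n : ℤ, if n ^ 2 = 0 then c n else 0) = c 0 := by
  rw [tsum_eq_single 0 (fun n hn => by simp [hn])]
  simp

theorem tsum_sq_add_self_ite (c : ℤ → ℂ) :
    (∑' n : ℤ, if n ^ 2 + n = 0 then c n else 0) = c 0 + c (-1) := by
  rw [tsum_eq_sum (s := {0, -1})]
  · simp
  · intro n hn
    rw [if_neg]
    intro h
    have : n * (n + 1) = 0 := by linarith
    rcases mul_eq_zero.1 this with h | h
    · simp [h] at hn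
    · simp [show n = -1 by omega] at hn

theorem summable_mul_exp_sq (k : ℕ) :
    Summable fun n : ℤ => (|n| ^ k : ℝ) * Real.exp (-π * (n ^ 2 : ℤ)) := by
  simpa using summable_pow_mul_jacobiTheta₂_term_bound 0 one_pos k

theorem summable_mul_exp_sq_add_self (k : ℕ) :
    Summable fun n : ℤ => (|n| ^ k : ℝ) * Real.exp (-π * (n ^ 2 + n : ℤ)) := by
  refine Summable.of_nonneg_of_le (fun n => by positivity) (fun n => ?_)
    -- With parameters $1/2$ and $1$ this bound is $e^{-\pi(n^2-|n|)}$, and $n^2+n\ge n^2-|n|$.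
    (summable_pow_mul_jacobiTheta₂_term_bound (1 / 2) one_pos k)
  refine mul_le_mul_of_nonneg_left (Real.exp_le_exp.2 ?_) (by positivity)
  push_cast
  nlinarith [neg_abs_le (n : ℝ), Real.pi_pos]

theorem tendsto_theta3_zero :
    Tendsto (fun τ => theta3 0 τ) (comap Complex.im atTop) (𝓝 1) := by
  have h := tendsto_tsum_nome (c := fun _ => 1) (p := fun n => n ^ 2) (fun n => sq_nonneg n)
    (by simpa using summable_mul_exp_sq 0)
  rw [tsum_sq_ite] at h
  refine h.congr' ?_
  filter_upwards [eventually_im_pos] with τ hτ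
  rw [theta3_eq hτ, jacobiTheta₂]
  refine tsum_congr fun n => ?_
  simp [jacobiTheta₂_term]

theorem tendsto_theta4_zero :
    Tendsto (fun τ => theta4 0 τ) (comap Complex.im atTop) (𝓝 1) := by
  have h := tendsto_tsum_nome (c := fun n => (-1) ^ n) (p := fun n => n ^ 2)
    (fun n => sq_nonneg n) (by simpa using summable_mul_exp_sq 0)
  rw [tsum_sq_ite] at h
  refine h.congr' ?_
  filter_upwards [eventually_im_pos] with τ hτ
  rw [theta4_eq hτ, jacobiTheta₂]
  refine tsum_congr fun n => ?_
  rw [jacobiTheta₂_term, ← exp_pi_mul_I, ← exp_int_mul, ← exp_add]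
  congr 1
  push_cast
  ring

/-- Once $q^{1/4}$ is removed the exponents are $n^2+n$, which vanish for $n=0$ and $n=-1$; this
accounts for the limit $2$. -/
theorem tendsto_theta2_zero :
    Tendsto (fun τ => exp (-(π * I * τ / 4)) * theta2 0 τ) (comap Complex.im atTop) (𝓝 2) := by
  have h := tendsto_tsum_nome (c := fun _ => 1) (p := fun n => n ^ 2 + n) sq_add_self_nonneg
    (by simpa using summable_mul_exp_sq_add_self 0)
  rw [tsum_sq_add_self_ite, one_add_one_eq_two] at h
  refine h.congr' ?_
  filter_upwards [eventually_im_pos] with τ hτ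
  rw [theta2_eq hτ, ← mul_assoc, ← exp_add, jacobiTheta₂]
  simp only [mul_zero, add_zero, neg_add_cancel, exp_zero, one_mul]
  refine tsum_congr fun n => ?_
  rw [jacobiTheta₂_term]
  congr 1
  push_cast
  ring

theorem deriv_theta1_zero {τ : ℂ} (hτ : 0 < τ.im) :
    HasDerivAt (fun u => theta1 u τ) (exp (π * I * τ / 4) *
      ∑' n : ℤ, (-1) ^ n * (2 * n + 1) * exp (π * I * (n ^ 2 + n : ℤ) * τ)) 0 := by
  have hπ : (π : ℂ) ≠ 0 := by exact_mod_cast Real.pi_ne_zero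
  have e : (fun u => theta1 u τ) = fun u => -I * (exp (π * I * τ / 4 + I * u) *
      jacobiTheta₂ (u / π + τ / 2 + 1 / 2) τ) := funext (theta1_eq hτ)
  have h1 : HasDerivAt (fun u : ℂ => u / π + τ / 2 + 1 / 2) (1 / π : ℂ) 0 :=
    (((hasDerivAt_id (0 : ℂ)).div_const (π : ℂ)).add_const _).add_const _
  have h2 : HasDerivAt (fun u : ℂ => π * I * τ / 4 + I * u) (I * 1) 0 :=
    ((hasDerivAt_id (0 : ℂ)).const_mul I).const_add _
  have h3 := (hasDerivAt_jacobiTheta₂_fst ((0 : ℂ) / π + τ / 2 + 1 / 2) hτ).comp 0 h1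
  have h := (h2.cexp.mul h3).const_mul (-I)
  rw [e]
  convert! h using 1
  simp only [zero_div, zero_add, mul_zero, add_zero, mul_one, Function.comp]
  have s1 := hasSum_jacobiTheta₂_term (τ / 2 + 1 / 2) hτ
  have s2 := hasSum_jacobiTheta₂'_term (τ / 2 + 1 / 2) hτ
  have s := ((s1.mul_left I).add (s2.mul_right (1 / π : ℂ))).mul_left (-I)
  have ht : (∑' n : ℤ, (-1) ^ n * (2 * n + 1) * exp (π * I * (n ^ 2 + n : ℤ) * τ)) =
      -I * (I * jacobiTheta₂ (τ / 2 + 1 / 2) τ +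
        jacobiTheta₂' (τ / 2 + 1 / 2) τ * (1 / π : ℂ)) := by
    rw [← s.tsum_eq]
    refine tsum_congr fun n => ?_
    have e3 : jacobiTheta₂_term n (τ / 2 + 1 / 2) τ =
        (-1) ^ n * exp (π * I * (n ^ 2 + n : ℤ) * τ) := by
      rw [jacobiTheta₂_term, ← exp_pi_mul_I, ← exp_int_mul, ← exp_add]
      congr 1
      push_cast
      ring
    rw [jacobiTheta₂'_term, e3]
    field_simp
    linear_combination (2 * (n : ℂ) + 1) * I_sq
  rw [ht]
  ring

/-- The coefficients $(-1)^n(2n+1)$ at $n=0$ and $n=-1$ are both $1$. -/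
theorem tendsto_deriv_theta1_zero :
    Tendsto (fun τ => exp (-(π * I * τ / 4)) * deriv (fun u => theta1 u τ) 0)
      (comap Complex.im atTop) (𝓝 2) := by
  have h := tendsto_tsum_nome (c := fun n => (-1) ^ n * (2 * n + 1)) (p := fun n => n ^ 2 + n)
    sq_add_self_nonneg ?_
  · rw [tsum_sq_add_self_ite] at h
    norm_num at h
    refine h.congr' ?_
    filter_upwards [eventually_im_pos] with τ hτ
    rw [(deriv_theta1_zero hτ).deriv, ← mul_assoc, ← exp_add, neg_add_cancel, exp_zero, one_mul]
    push_cast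
    rfl
  · refine Summable.of_nonneg_of_le (fun n => by positivity) (fun n => ?_)
      (((summable_mul_exp_sq_add_self 1).mul_left 2).add (summable_mul_exp_sq_add_self 0))
    have : ‖((-1 : ℂ)) ^ n * (2 * n + 1)‖ ≤ 2 * |(n : ℝ)| + 1 := by
      rw [norm_mul, norm_zpow, norm_neg, norm_one, one_zpow, one_mul]
      refine (norm_add_le _ _).trans ?_
      simp
    refine (mul_le_mul_of_nonneg_right this (Real.exp_nonneg _)).trans (le_of_eq ?_)
    push_cast
    ring

theorem tendsto_two_pow_mul {τ : ℂ} (hτ : 0 < τ.im) :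
    Tendsto (fun n : ℕ => 2 ^ n * τ) atTop (comap Complex.im atTop) := by
  rw [tendsto_comap_iff]
  have : (Complex.im ∘ fun n : ℕ => 2 ^ n * τ) = fun n : ℕ => (2 : ℝ) ^ n * τ.im := by
    funext n
    have : ((2 : ℂ) ^ n) = ((2 ^ n : ℝ) : ℂ) := by push_cast; rfl
    simp only [Function.comp, this, im_ofReal_mul]
  rw [this]
  exact (tendsto_pow_atTop_atTop_of_one_lt one_lt_two).atTop_mul_const hτ

theorem im_two_pow_mul_pos {τ : ℂ} (hτ : 0 < τ.im) (n : ℕ) : 0 < (2 ^ n * τ).im := by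
  have : ((2 : ℂ) ^ n) = ((2 ^ n : ℝ) : ℂ) := by push_cast; rfl
  rw [this, im_ofReal_mul]
  positivity

/-! ### Theta constants -/

theorem theta4_zero_two_mul_sq {τ : ℂ} (hτ : 0 < τ.im) :
    theta4 0 (2 * τ) ^ 2 = theta3 0 τ * theta4 0 τ := by
  have h := theta4_mul_theta4_two_mul hτ 0 0
  simp only [add_zero, sub_zero] at h
  linear_combination h / 2

theorem theta2_mul_theta3_zero_two_mul {τ : ℂ} (hτ : 0 < τ.im) :
    2 * (theta2 0 (2 * τ) * theta3 0 (2 * τ)) = theta2 0 τ ^ 2 := by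
  have h := theta2_mul_theta3_two_mul hτ 0 0
  simp only [add_zero, sub_zero, theta1_zero] at h
  linear_combination h

/-- The constants are nonzero near the cusp, in particular at $2^n\tau$ for some $n$. The doubling
formulas express $\Theta_4(0|2\sigma)^2$ and $\Theta_2\Theta_3(0|2\sigma)$ as products of constants
at $\sigma$, so nonvanishing descends from $2\sigma$ to $\sigma$. -/
theorem theta_zero_ne_zero {τ : ℂ} (hτ : 0 < τ.im) :
    theta2 0 τ ≠ 0 ∧ theta3 0 τ ≠ 0 ∧ theta4 0 τ ≠ 0 := by
  have hev : ∀ᶠ τ in comap Complex.im atTop,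
      theta2 0 τ ≠ 0 ∧ theta3 0 τ ≠ 0 ∧ theta4 0 τ ≠ 0 := by
    filter_upwards [tendsto_theta2_zero.eventually_ne two_ne_zero,
      tendsto_theta3_zero.eventually_ne one_ne_zero,
      tendsto_theta4_zero.eventually_ne one_ne_zero] with τ h2 h3 h4
    exact ⟨right_ne_zero_of_mul h2, h3, h4⟩
  obtain ⟨n, hn⟩ := ((tendsto_two_pow_mul hτ).eventually hev).exists
  induction n with
  | zero => simpa using hn
  | succ n ih =>
    refine ih ?_
    have hpos := im_two_pow_mul_pos hτ n
    rw [pow_succ', mul_assoc] at hn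
    have h4 := theta4_zero_two_mul_sq hpos
    have h2 := theta2_mul_theta3_zero_two_mul hpos
    have h4' : theta3 0 (2 ^ n * τ) * theta4 0 (2 ^ n * τ) ≠ 0 := h4 ▸ pow_ne_zero 2 hn.2.2
    have h2' : theta2 0 (2 ^ n * τ) ^ 2 ≠ 0 :=
      h2 ▸ mul_ne_zero two_ne_zero (mul_ne_zero hn.1 hn.2.1)
    exact ⟨fun h => h2' (by rw [h]; ring), left_ne_zero_of_mul h4', right_ne_zero_of_mul h4'⟩

theorem differentiable_theta1 {τ : ℂ} (hτ : 0 < τ.im) : Differentiable ℂ fun u => theta1 u τ := by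
  have e : (fun u => theta1 u τ) = fun u => -I * (exp (π * I * τ / 4 + I * u) *
      jacobiTheta₂ (u / π + τ / 2 + 1 / 2) τ) := funext (theta1_eq hτ)
  rw [e]
  have h : Differentiable ℂ fun z => jacobiTheta₂ z τ :=
    fun z => differentiableAt_jacobiTheta₂_fst z hτ
  have h' : Differentiable ℂ fun u : ℂ => jacobiTheta₂ (u / π + τ / 2 + 1 / 2) τ :=
    h.comp (by fun_prop)
  fun_prop

theorem differentiable_theta2 {τ : ℂ} (hτ : 0 < τ.im) : Differentiable ℂ fun u => theta2 u τ := by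
  have e : (fun u => theta2 u τ) = fun u => exp (π * I * τ / 4 + I * u) *
      jacobiTheta₂ (u / π + τ / 2) τ := funext (theta2_eq hτ)
  rw [e]
  have h : Differentiable ℂ fun z => jacobiTheta₂ z τ :=
    fun z => differentiableAt_jacobiTheta₂_fst z hτ
  have h' : Differentiable ℂ fun u : ℂ => jacobiTheta₂ (u / π + τ / 2) τ := h.comp (by fun_prop)
  fun_prop

theorem differentiable_theta3 {τ : ℂ} (hτ : 0 < τ.im) : Differentiable ℂ fun u => theta3 u τ := by
  have e : (fun u => theta3 u τ) = fun u => jacobiTheta₂ (u / π) τ := funext (theta3_eq hτ)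
  rw [e]
  have h : Differentiable ℂ fun z => jacobiTheta₂ z τ :=
    fun z => differentiableAt_jacobiTheta₂_fst z hτ
  exact h.comp (by fun_prop)

theorem differentiable_theta4 {τ : ℂ} (hτ : 0 < τ.im) : Differentiable ℂ fun u => theta4 u τ := by
  have e : (fun u => theta4 u τ) = fun u => jacobiTheta₂ (u / π + 1 / 2) τ :=
    funext (theta4_eq hτ)
  rw [e]
  have h : Differentiable ℂ fun z => jacobiTheta₂ z τ :=
    fun z => differentiableAt_jacobiTheta₂_fst z hτ
  exact h.comp (by fun_prop)

theorem deriv_theta2_zero (τ : ℂ) : deriv (fun u => theta2 u τ) 0 = 0 := by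
  have h := deriv_comp_neg (fun u => theta2 u τ) 0
  simp only [theta2_neg, neg_zero] at h
  exact CharZero.eq_neg_self_iff.1 h

/-- The Wronskian of `Θ₁` and `Θ₄` in terms of the theta functions of half the period. -/
theorem theta_wronskian_two_mul {τ : ℂ} (hτ : 0 < τ.im) (u : ℂ) :
    2 * (deriv (fun u => theta1 u (2 * τ)) u * theta4 u (2 * τ) -
      theta1 u (2 * τ) * deriv (fun u => theta4 u (2 * τ)) u) =
    theta2 u τ * deriv (fun u => theta1 u τ) 0 := by
  have hτ2 : 0 < (2 * τ).im := by simpa using hτ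
  have d1 : HasDerivAt (fun y => theta1 (u + y) (2 * τ))
      (deriv (fun u => theta1 u (2 * τ)) u) 0 := by
    have := (differentiable_theta1 hτ2 (u + 0)).hasDerivAt.comp_const_add u 0
    simpa using this
  have d4 : HasDerivAt (fun y => theta4 (u - y) (2 * τ))
      (-deriv (fun u => theta4 u (2 * τ)) u) 0 := by
    have := (differentiable_theta4 hτ2 (u - 0)).hasDerivAt.comp_const_sub u 0
    simpa using this
  have hL := (d1.mul d4).const_mul 2
  -- The doubling formula for $\Theta_1(u+y)\Theta_4(u-y)$ is differentiated in $y$ at $0$; the left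
  -- side yields the Wronskian, and $\Theta_2'(0)=0$ removes one term on the right.
  have hR := ((differentiable_theta2 hτ 0).hasDerivAt.const_mul (theta1 u τ)).add
    ((differentiable_theta1 hτ 0).hasDerivAt.const_mul (theta2 u τ))
  have e : (fun y => 2 * (theta1 (u + y) (2 * τ) * theta4 (u - y) (2 * τ))) =
      fun y => theta1 u τ * theta2 y τ + theta2 u τ * theta1 y τ :=
    funext fun y => theta1_mul_theta4_two_mul hτ u y
  have hL' : HasDerivAt (fun y => 2 * (theta1 (u + y) (2 * τ) * theta4 (u - y) (2 * τ))) _ 0 := hL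
  rw [e] at hL'
  have := hL'.unique hR
  simp only [add_zero, sub_zero, deriv_theta2_zero, mul_zero, zero_add] at this
  linear_combination this

/-- Jacobi's derivative formula. -/
theorem deriv_theta1_zero_eq {τ : ℂ} (hτ : 0 < τ.im) :
    deriv (fun u => theta1 u τ) 0 = theta2 0 τ * theta3 0 τ * theta4 0 τ := by
  set R : ℂ → ℂ := fun τ => deriv (fun u => theta1 u τ) 0 / (theta2 0 τ * theta3 0 τ * theta4 0 τ)
    with hR
  -- Invariance under doubling makes `R` constant along $2^n\tau$, so it equals its limit at the
  -- cusp.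
  have hstep (τ : ℂ) (hτ : 0 < τ.im) : R (2 * τ) = R τ := by
    have hτ2 : 0 < (2 * τ).im := by simpa using hτ
    obtain ⟨a2, a3, a4⟩ := theta_zero_ne_zero hτ
    obtain ⟨b2, b3, b4⟩ := theta_zero_ne_zero hτ2
    have h := theta_wronskian_two_mul hτ 0
    have h2 := theta2_mul_theta3_zero_two_mul hτ
    have h4 := theta4_zero_two_mul_sq hτ
    rw [theta1_zero, zero_mul, sub_zero] at h
    simp only [hR]
    rw [div_eq_div_iff (by positivity) (by positivity)]
    apply mul_left_cancel₀ b4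
    linear_combination (theta2 0 τ * theta3 0 τ * theta4 0 τ / 2) * h -
      deriv (fun u => theta1 u τ) 0 * theta2 0 (2 * τ) * theta3 0 (2 * τ) * h4 -
      deriv (fun u => theta1 u τ) 0 * theta3 0 τ * theta4 0 τ / 2 * h2
  have hpow (n : ℕ) : R (2 ^ n * τ) = R τ := by
    induction n with
    | zero => simp
    | succ n ih => rw [pow_succ', mul_assoc, hstep _ (im_two_pow_mul_pos hτ n), ih]
  have hlim : Tendsto R (comap Complex.im atTop) (𝓝 1) := by
    have := tendsto_deriv_theta1_zero.div
      ((tendsto_theta2_zero.mul tendsto_theta3_zero).mul tendsto_theta4_zero) (by norm_num)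
    norm_num at this
    refine this.congr fun τ => ?_
    simp only [hR, Pi.div_apply]
    -- Numerator and denominator carry the same factor $q^{-1/4}$.
    rw [show exp (-(π * I * τ / 4)) * theta2 0 τ * theta3 0 τ * theta4 0 τ =
      exp (-(π * I * τ / 4)) * (theta2 0 τ * theta3 0 τ * theta4 0 τ) by ring,
      mul_div_mul_left _ _ (exp_ne_zero _)]
  have hone : R τ = 1 := by
    refine tendsto_nhds_unique ?_ (hlim.comp (tendsto_two_pow_mul hτ))
    simp only [Function.comp_def, hpow]
    exact tendsto_const_nhds
  obtain ⟨a2, a3, a4⟩ := theta_zero_ne_zero hτ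
  rwa [hR, div_eq_one_iff_eq (by positivity)] at hone

/-- At the half period $\sigma=\tau/2$ the Wronskian is
$\tfrac12\Theta_2(u|\sigma)\Theta_1'(0|\sigma)$. Jacobi's formula and the doubling formulas for
$\Theta_2\Theta_3$ and $\Theta_4^2$ bring this back to $\tau$. -/
theorem theta_wronskian {τ : ℂ} (hτ : 0 < τ.im) (u : ℂ) :
    deriv (fun u => theta1 u τ) u * theta4 u τ - theta1 u τ * deriv (fun u => theta4 u τ) u =
      theta4 0 τ ^ 2 * (theta2 u τ * theta3 u τ) := by
  have hσ : 0 < (τ / 2).im := by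
    have : (τ / 2).im = τ.im / 2 := by simp
    rw [this]
    positivity
  obtain ⟨σ, rfl⟩ : ∃ σ, τ = 2 * σ := ⟨τ / 2, by ring⟩
  rw [mul_div_cancel_left₀ _ two_ne_zero] at hσ
  have h := theta_wronskian_two_mul hσ u
  have h23 := theta2_mul_theta3_two_mul hσ (u / 2 + u / 2) 0
  have h4 := theta4_zero_two_mul_sq hσ
  rw [deriv_theta1_zero_eq hσ] at h
  simp only [add_halves, add_zero, sub_zero, theta1_zero, mul_zero] at h23
  linear_combination h / 2 - theta2 u (2 * σ) * theta3 u (2 * σ) * h4 -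
    theta3 0 σ * theta4 0 σ / 2 * h23

/-! ### Quadratic relations -/

/-- By doubling, all squares at $u$ and at $0$ are quadratic polynomials in $\Theta_2,\Theta_3$ of
period $2\tau$ at $2u$ and $0$; the relations become polynomial identities. -/
theorem theta_sq_relations {τ : ℂ} (hτ : 0 < τ.im) (u : ℂ) :
    theta3 0 τ ^ 2 * theta1 u τ ^ 2 + theta4 0 τ ^ 2 * theta2 u τ ^ 2 =
      theta2 0 τ ^ 2 * theta4 u τ ^ 2 ∧
    theta4 0 τ ^ 2 * theta3 u τ ^ 2 + theta2 0 τ ^ 2 * theta1 u τ ^ 2 =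
      theta3 0 τ ^ 2 * theta4 u τ ^ 2 := by
  have a1 := theta3_mul_theta3_two_mul hτ u u
  have a2 := theta2_mul_theta2_two_mul hτ u u
  have a3 := theta2_mul_theta3_two_mul hτ u u
  -- Replacing $y=u$ by $-u$ flips the sign of $\Theta_1^2$, which separates $\Theta_1^2$ from
  -- $\Theta_2^2$.
  have a4 := theta2_mul_theta3_two_mul hτ u (-u)
  have b1 := theta3_mul_theta3_two_mul hτ 0 0
  have b2 := theta2_mul_theta2_two_mul hτ 0 0
  have b3 := theta2_mul_theta3_two_mul hτ 0 0
  simp only [sub_self, add_zero, theta1_zero, sub_neg_eq_add, theta1_neg, theta2_neg,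
    add_neg_cancel] at a1 a2 a3 a4 b1 b2 b3
  have e1 : theta1 u τ ^ 2 = theta2 0 (2 * τ) * theta3 (u + u) (2 * τ) -
    theta2 (u + u) (2 * τ) * theta3 0 (2 * τ) := by linear_combination (a3 - a4) / 2
  have e2 : theta2 u τ ^ 2 = theta2 0 (2 * τ) * theta3 (u + u) (2 * τ) +
    theta2 (u + u) (2 * τ) * theta3 0 (2 * τ) := by linear_combination -(a3 + a4) / 2
  have e3 : theta3 u τ ^ 2 = theta3 (u + u) (2 * τ) * theta3 0 (2 * τ) +
    theta2 (u + u) (2 * τ) * theta2 0 (2 * τ) := by linear_combination -(a1 + a2) / 2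
  have e4 : theta4 u τ ^ 2 = theta3 (u + u) (2 * τ) * theta3 0 (2 * τ) -
    theta2 (u + u) (2 * τ) * theta2 0 (2 * τ) := by linear_combination (a2 - a1) / 2
  have f2 : theta2 0 τ ^ 2 = 2 * theta2 0 (2 * τ) * theta3 0 (2 * τ) := by linear_combination -b3
  have f3 : theta3 0 τ ^ 2 = theta3 0 (2 * τ) ^ 2 + theta2 0 (2 * τ) ^ 2 := by
    linear_combination -(b1 + b2) / 2
  have f4 : theta4 0 τ ^ 2 = theta3 0 (2 * τ) ^ 2 - theta2 0 (2 * τ) ^ 2 := by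
    linear_combination (b2 - b1) / 2
  rw [e1, e2, e3, e4, f2, f3, f4]
  constructor <;> ring

theorem theta_zero_pow_four {τ : ℂ} (hτ : 0 < τ.im) :
    theta2 0 τ ^ 4 + theta4 0 τ ^ 4 = theta3 0 τ ^ 4 := by
  have b1 := theta3_mul_theta3_two_mul hτ 0 0
  have b2 := theta2_mul_theta2_two_mul hτ 0 0
  have b3 := theta2_mul_theta3_two_mul hτ 0 0
  simp only [sub_self, add_zero, theta1_zero] at b1 b2 b3
  linear_combination 2 * theta2 0 (2 * τ) ^ 2 * b1 + (theta3 0 τ ^ 2 + theta4 0 τ ^ 2) * b2 -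
    (2 * theta2 0 (2 * τ) * theta3 0 (2 * τ) + theta2 0 τ ^ 2) * b3

/-! ### Meromorphic functions on the plane -/

theorem eventually_nhdsNE_of_codiscrete {p : ℂ → Prop} (h : ∀ᶠ z in codiscrete ℂ, p z) (x : ℂ) :
    ∀ᶠ z in 𝓝[≠] x, p z := by
  have := mem_codiscrete.1 h x
  rwa [disjoint_principal_right, compl_compl] at this

theorem eventually_codiscrete_of_nhdsNE {p : ℂ → Prop} (h : ∀ x, ∀ᶠ z in 𝓝[≠] x, p z) :
    ∀ᶠ z in codiscrete ℂ, p z := by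
  refine mem_codiscrete.2 fun x => ?_
  rw [disjoint_principal_right, compl_compl]
  exact h x

/-- Codiscrete sets are open; hence identities off a discrete set may be differentiated. -/
theorem eventually_codiscrete_nhds {p : ℂ → Prop} (h : ∀ᶠ z in codiscrete ℂ, p z) :
    ∀ᶠ z in codiscrete ℂ, ∀ᶠ w in 𝓝 z, p w := by
  filter_upwards [h] with z hz using (mem_codiscrete'.1 h).1.mem_nhds hz

/-- Identity theorem: the plane is connected, so the order is infinite everywhere or nowhere. -/
theorem eventuallyEq_zero_or_eventually_ne_zero {f : ℂ → ℂ} (hf : Meromorphic f) :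
    f =ᶠ[codiscrete ℂ] 0 ∨ ∀ᶠ z in codiscrete ℂ, f z ≠ 0 := by
  have hf' : MeromorphicOn f Set.univ := hf.meromorphicOn
  by_cases h : ∃ u ∈ Set.univ, meromorphicOrderAt f u ≠ ⊤
  · right
    exact hf'.eventually_codiscreteWithin_apply_ne_zero
      ((hf'.exists_meromorphicOrderAt_ne_top_iff_forall_mem isConnected_univ).1 h)
  · left
    push Not at h
    exact eventually_codiscrete_of_nhdsNE fun x => meromorphicOrderAt_eq_top_iff.1 (h x trivial)

theorem eventuallyEq_codiscrete_of_nhdsNE {f g : ℂ → ℂ} (hf : Meromorphic f) (hg : Meromorphic g)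
    {x : ℂ} (h : f =ᶠ[𝓝[≠] x] g) : f =ᶠ[codiscrete ℂ] g := by
  rcases eventuallyEq_zero_or_eventually_ne_zero (hf.sub hg) with h' | h'
  · exact h'.mono fun z hz => sub_eq_zero.1 hz
  · obtain ⟨z, h1, h2⟩ := (h.and (eventually_nhdsNE_of_codiscrete h' x)).exists
    exact absurd (sub_eq_zero.2 h1) h2

theorem eventually_ne_zero_of_tendsto {f : ℂ → ℂ} (hf : Meromorphic f) {x a : ℂ} (ha : a ≠ 0)
    (h : Tendsto f (𝓝[≠] x) (𝓝 a)) : ∀ᶠ z in codiscrete ℂ, f z ≠ 0 := by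
  refine (eventuallyEq_zero_or_eventually_ne_zero hf).resolve_left fun h0 => ?_
  obtain ⟨z, h1, h2⟩ :=
    ((h.eventually_ne ha).and (eventually_nhdsNE_of_codiscrete h0 x)).exists
  exact h1 h2

theorem tendsto_const_mul_codiscrete {a : ℂ} (ha : a ≠ 0) :
    Tendsto (fun z => a * z) (codiscrete ℂ) (codiscrete ℂ) := by
  intro s hs
  refine eventually_codiscrete_of_nhdsNE fun x => ?_
  have h := eventually_nhdsNE_of_codiscrete hs (a * x)
  have ht : Tendsto (fun z => a * z) (𝓝[≠] x) (𝓝[≠] (a * x)) :=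
    tendsto_nhdsWithin_iff.2
      ⟨(continuous_const_mul a).continuousAt.tendsto.mono_left nhdsWithin_le_nhds,
        eventually_mem_nhdsWithin.mono fun z hz h => hz (mul_left_cancel₀ ha h)⟩
  exact ht.eventually h

theorem meromorphic_comp_const_mul {f : ℂ → ℂ} (hf : Meromorphic f) (a : ℂ) :
    Meromorphic fun z => f (a * z) := fun x => by
  exact (hf (a * x)).comp_analyticAt (g := fun z => a * z) (by fun_prop)

theorem meromorphicNFOn_regularize (f : ℂ → ℂ) : MeromorphicNFOn (regularize f) Set.univ :=
  meromorphicNFOn_toMeromorphicNFOn _ _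

theorem meromorphic_regularize (f : ℂ → ℂ) : Meromorphic (regularize f) :=
  fun x => (meromorphicNFOn_regularize f (Set.mem_univ x)).meromorphicAt

theorem regularize_eventuallyEq {f : ℂ → ℂ} (hf : Meromorphic f) :
    regularize f =ᶠ[codiscrete ℂ] f :=
  (toMeromorphicNFOn_eqOn_codiscrete hf.meromorphicOn).symm

/-- This turns identities off a discrete set into identities at every point, poles included. -/
theorem MeromorphicNFOn.eq_of_eventuallyEq {f g : ℂ → ℂ} (hf : MeromorphicNFOn f Set.univ)
    (hg : MeromorphicNFOn g Set.univ) (h : f =ᶠ[codiscrete ℂ] g) : f = g := by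
  funext x
  exact (((hf (Set.mem_univ x)).eventuallyEq_nhdsNE_iff_eventuallyEq_nhds
    (hg (Set.mem_univ x))).1 (eventually_nhdsNE_of_codiscrete h x)).eq_of_nhds

theorem MeromorphicNFOn.comp_const_mul {f : ℂ → ℂ} (hf : MeromorphicNFOn f Set.univ) (a : ℂ) :
    MeromorphicNFOn (fun z => f (a * z)) Set.univ := fun x _ =>
  (hf (Set.mem_univ (a * x))).comp_analyticAt (g := fun z => a * z) (by fun_prop)

theorem MeromorphicNFOn.const_mul {f : ℂ → ℂ} (hf : MeromorphicNFOn f Set.univ) {a : ℂ}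
    (ha : a ≠ 0) : MeromorphicNFOn (fun z => a * f z) Set.univ := fun x _ =>
  (meromorphicNFAt_mul_iff_right (g := fun _ => a) analyticAt_const ha).2 (hf (Set.mem_univ x))

/-- A finite limit means nonnegative order, and a normal form of nonnegative order is analytic. -/
theorem analyticAt_regularize {f : ℂ → ℂ} (hf : Meromorphic f) {x a : ℂ}
    (h : Tendsto f (𝓝[≠] x) (𝓝 a)) : AnalyticAt ℂ (regularize f) x ∧ regularize f x = a := by
  have hNF := meromorphicNFOn_regularize f (Set.mem_univ x)
  have ht : Tendsto (regularize f) (𝓝[≠] x) (𝓝 a) :=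
    h.congr' (eventually_nhdsNE_of_codiscrete (regularize_eventuallyEq hf).symm x)
  have ha : AnalyticAt ℂ (regularize f) x := by
    rw [← hNF.meromorphicOrderAt_nonneg_iff_analyticAt]
    exact (tendsto_nhds_iff_meromorphicOrderAt_nonneg hNF.meromorphicAt).1 ⟨a, ht⟩
  exact ⟨ha, tendsto_nhds_unique (ha.continuousAt.tendsto.mono_left nhdsWithin_le_nhds) ht⟩

theorem HasDerivAt.congr_codiscrete {f f' g g' : ℂ → ℂ}
    (h : ∀ᶠ z in codiscrete ℂ, HasDerivAt f (f' z) z) (hf : g =ᶠ[codiscrete ℂ] f)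
    (hf' : g' =ᶠ[codiscrete ℂ] f') : ∀ᶠ z in codiscrete ℂ, HasDerivAt g (g' z) z := by
  filter_upwards [h, eventually_codiscrete_nhds hf, hf'] with z h1 h2 h3
  rw [h3]
  exact h1.congr_of_eventuallyEq h2

/-! ### Solutions of the differential equations of the Jacobi functions -/

/-- Meromorphic functions `s, c, d` with the initial values `0, 1, 1` that satisfy the differential
equations and the quadratic relations of the Jacobi functions of squared modulus `m`. -/
structure JacobiTriple (m : ℂ) (s c d : ℂ → ℂ) : Prop where
  meromorphic_s : Meromorphic s
  meromorphic_c : Meromorphic c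
  meromorphic_d : Meromorphic d
  tendsto_s : Tendsto s (𝓝[≠] 0) (𝓝 0)
  tendsto_c : Tendsto c (𝓝[≠] 0) (𝓝 1)
  tendsto_d : Tendsto d (𝓝[≠] 0) (𝓝 1)
  deriv_s : ∀ᶠ z in codiscrete ℂ, HasDerivAt s (c z * d z) z
  deriv_c : ∀ᶠ z in codiscrete ℂ, HasDerivAt c (-(s z * d z)) z
  deriv_d : ∀ᶠ z in codiscrete ℂ, HasDerivAt d (-(m * s z * c z)) z
  sq_s_add_sq_c : ∀ᶠ z in codiscrete ℂ, s z ^ 2 + c z ^ 2 = 1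
  sq_d_add_sq_s : ∀ᶠ z in codiscrete ℂ, d z ^ 2 + m * s z ^ 2 = 1

namespace JacobiTriple

variable {m : ℂ} {s c d s' c' d' : ℂ → ℂ}

theorem congr (h : JacobiTriple m s c d) (hs : s' =ᶠ[codiscrete ℂ] s)
    (hc : c' =ᶠ[codiscrete ℂ] c) (hd : d' =ᶠ[codiscrete ℂ] d) : JacobiTriple m s' c' d' where
  meromorphic_s := h.meromorphic_s.congr_codiscrete hs.symm
  meromorphic_c := h.meromorphic_c.congr_codiscrete hc.symm
  meromorphic_d := h.meromorphic_d.congr_codiscrete hd.symm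
  tendsto_s := h.tendsto_s.congr' (eventually_nhdsNE_of_codiscrete hs.symm 0)
  tendsto_c := h.tendsto_c.congr' (eventually_nhdsNE_of_codiscrete hc.symm 0)
  tendsto_d := h.tendsto_d.congr' (eventually_nhdsNE_of_codiscrete hd.symm 0)
  deriv_s := HasDerivAt.congr_codiscrete h.deriv_s hs (hc.mul hd)
  deriv_c := HasDerivAt.congr_codiscrete h.deriv_c hc (hs.mul hd).neg
  deriv_d := HasDerivAt.congr_codiscrete h.deriv_d hd
    ((hs.mul hc).mono fun z hz => by simp only [Pi.mul_apply] at hz; linear_combination -m * hz)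
  sq_s_add_sq_c := by filter_upwards [hs, hc, h.sq_s_add_sq_c] with z h1 h2 h3; rwa [h1, h2]
  sq_d_add_sq_s := by filter_upwards [hs, hd, h.sq_d_add_sq_s] with z h1 h2 h3; rwa [h1, h2]

theorem c_ne_zero (h : JacobiTriple m s c d) : ∀ᶠ z in codiscrete ℂ, c z ≠ 0 :=
  eventually_ne_zero_of_tendsto h.meromorphic_c one_ne_zero h.tendsto_c

theorem d_ne_zero (h : JacobiTriple m s c d) : ∀ᶠ z in codiscrete ℂ, d z ≠ 0 :=
  eventually_ne_zero_of_tendsto h.meromorphic_d one_ne_zero h.tendsto_d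

/-- The initial value $0$ gives no information here; but $s\equiv0$ would force $cd=s'\equiv0$. -/
theorem s_ne_zero (h : JacobiTriple m s c d) : ∀ᶠ z in codiscrete ℂ, s z ≠ 0 := by
  refine (eventuallyEq_zero_or_eventually_ne_zero h.meromorphic_s).resolve_left fun h0 => ?_
  have := eventually_nhdsNE_of_codiscrete
    ((((eventually_codiscrete_nhds h0).and h.deriv_s).and h.c_ne_zero).and h.d_ne_zero) 0
  obtain ⟨z, ⟨⟨h1, h2⟩, h3⟩, h4⟩ := this.exists
  have h5 : HasDerivAt s 0 z := (hasDerivAt_const z (0 : ℂ)).congr_of_eventuallyEq h1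
  exact mul_ne_zero h3 h4 (h2.unique h5)

theorem regularize (h : JacobiTriple m s c d) : JacobiTriple m (JacobiElliptic.regularize s)
    (JacobiElliptic.regularize c) (JacobiElliptic.regularize d) :=
  h.congr (regularize_eventuallyEq h.meromorphic_s) (regularize_eventuallyEq h.meromorphic_c)
    (regularize_eventuallyEq h.meromorphic_d)

end JacobiTriple

/-- Both sides of the equation are analytic at $x$, so it extends across the exceptional points near
$x$. -/
theorem eventually_hasDerivAt_nhds {f g : ℂ → ℂ} {x : ℂ} (hf : AnalyticAt ℂ f x)
    (hg : AnalyticAt ℂ g x) (h : ∀ᶠ z in codiscrete ℂ, HasDerivAt f (g z) z) :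
    ∀ᶠ z in 𝓝 x, HasDerivAt f (g z) z := by
  have h1 : ∃ᶠ z in 𝓝[≠] x, deriv f z = g z :=
    ((eventually_nhdsNE_of_codiscrete h x).mono fun z hz => hz.deriv).frequently
  filter_upwards [(hf.deriv.frequently_eq_iff_eventually_eq hg).1 h1,
    hf.eventually_analyticAt] with z h2 h3
  exact h2 ▸ h3.differentiableAt.hasDerivAt

/-- The velocity field of the differential equations of the Jacobi functions. -/
def jacobiField (m : ℂ) (p : ℂ × ℂ × ℂ) : ℂ × ℂ × ℂ :=
  (p.2.1 * p.2.2, -(p.1 * p.2.2), -(m * p.1 * p.2.1))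

/-- Restriction to the real axis gives an ordinary differential equation in real time, to which the
uniqueness theorem applies. -/
theorem JacobiTriple.eventually_curve {m : ℂ} {s c d : ℂ → ℂ} (h : JacobiTriple m s c d)
    (hs : AnalyticAt ℂ s 0) (hc : AnalyticAt ℂ c 0) (hd : AnalyticAt ℂ d 0) :
    ∀ᶠ t : ℝ in 𝓝 0, HasDerivAt (fun t : ℝ => (s t, c t, d t))
      (jacobiField m (s t, c t, d t)) t := by
  have ht : Tendsto (fun t : ℝ => (t : ℂ)) (𝓝 0) (𝓝 0) := by
    simpa using Complex.continuous_ofReal.tendsto 0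
  filter_upwards [ht.eventually (eventually_hasDerivAt_nhds hs (hc.mul hd) h.deriv_s),
    ht.eventually (eventually_hasDerivAt_nhds hc (hs.mul hd).neg h.deriv_c),
    ht.eventually (eventually_hasDerivAt_nhds hd
      ((analyticAt_const (v := m)).mul hs |>.mul hc).neg h.deriv_d)] with t h1 h2 h3
  exact h1.comp_ofReal.prodMk (h2.comp_ofReal.prodMk h3.comp_ofReal)

/-- The polynomial velocity field is locally Lipschitz, so the solutions agree at real points near
$0$. These accumulate at $0$, and the identity theorem does the rest. -/
theorem JacobiTriple.eventuallyEq_of_analyticAt {m : ℂ} {s c d s' c' d' : ℂ → ℂ}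
    (h : JacobiTriple m s c d) (h' : JacobiTriple m s' c' d')
    (hs : AnalyticAt ℂ s 0) (hc : AnalyticAt ℂ c 0) (hd : AnalyticAt ℂ d 0)
    (hs' : AnalyticAt ℂ s' 0) (hc' : AnalyticAt ℂ c' 0) (hd' : AnalyticAt ℂ d' 0)
    (es : s 0 = s' 0) (ec : c 0 = c' 0) (ed : d 0 = d' 0) :
    s =ᶠ[codiscrete ℂ] s' ∧ c =ᶠ[codiscrete ℂ] c' ∧ d =ᶠ[codiscrete ℂ] d' := by
  have hF : ContDiff ℝ 1 (jacobiField m) := by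
    unfold jacobiField
    fun_prop
  obtain ⟨K, U, hU, hK⟩ := (hF.contDiffAt (x := (s 0, c 0, d 0))).exists_lipschitzOnWith
  have hmem {f : ℝ → ℂ × ℂ × ℂ} {v : ℂ × ℂ × ℂ} (hd : HasDerivAt f v 0)
      (h0 : f 0 = (s 0, c 0, d 0)) : ∀ᶠ t in 𝓝 0, f t ∈ U :=
    hd.continuousAt.eventually_mem (h0 ▸ hU)
  have e1 := h.eventually_curve hs hc hd
  have e2 := h'.eventually_curve hs' hc' hd'
  have heq := ODE_solution_unique_of_eventually (v := fun _ => jacobiField m) (s := fun _ => U)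
    (K := K) (Eventually.of_forall fun _ => hK)
    (e1.and (hmem e1.self_of_nhds (by simp)))
    (e2.and (hmem e2.self_of_nhds (by simp [es, ec, ed]))) (by simp [es, ec, ed])
  have ht : Tendsto (fun t : ℝ => (t : ℂ)) (𝓝[≠] 0) (𝓝[≠] 0) := by
    refine tendsto_nhdsWithin_iff.2
      ⟨?_, eventually_mem_nhdsWithin.mono fun z hz => by simpa using hz⟩
    simpa using (Complex.continuous_ofReal.tendsto 0).mono_left nhdsWithin_le_nhds
  have hlift {f g : ℂ → ℂ} (hf : Meromorphic f) (hg : Meromorphic g) (hfa : AnalyticAt ℂ f 0)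
      (hga : AnalyticAt ℂ g 0) (hfg : ∀ᶠ t : ℝ in 𝓝 0, f t = g t) : f =ᶠ[codiscrete ℂ] g := by
    refine eventuallyEq_codiscrete_of_nhdsNE hf hg (x := 0) ?_
    refine Filter.Eventually.filter_mono nhdsWithin_le_nhds
      ((hfa.frequently_eq_iff_eventually_eq hga).1 ?_)
    exact ht.frequently (hfg.filter_mono nhdsWithin_le_nhds).frequently
  exact ⟨hlift h.meromorphic_s h'.meromorphic_s hs hs' (heq.mono fun t ht => congrArg Prod.fst ht),
    hlift h.meromorphic_c h'.meromorphic_c hc hc' (heq.mono fun t ht => congrArg (·.2.1) ht),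
    hlift h.meromorphic_d h'.meromorphic_d hd hd' (heq.mono fun t ht => congrArg (·.2.2) ht)⟩

theorem JacobiTriple.eventuallyEq {m : ℂ} {s c d s' c' d' : ℂ → ℂ}
    (h : JacobiTriple m s c d) (h' : JacobiTriple m s' c' d') :
    s =ᶠ[codiscrete ℂ] s' ∧ c =ᶠ[codiscrete ℂ] c' ∧ d =ᶠ[codiscrete ℂ] d' := by
  obtain ⟨a1, b1⟩ := analyticAt_regularize h.meromorphic_s h.tendsto_s
  obtain ⟨a2, b2⟩ := analyticAt_regularize h.meromorphic_c h.tendsto_c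
  obtain ⟨a3, b3⟩ := analyticAt_regularize h.meromorphic_d h.tendsto_d
  obtain ⟨a1', b1'⟩ := analyticAt_regularize h'.meromorphic_s h'.tendsto_s
  obtain ⟨a2', b2'⟩ := analyticAt_regularize h'.meromorphic_c h'.tendsto_c
  obtain ⟨a3', b3'⟩ := analyticAt_regularize h'.meromorphic_d h'.tendsto_d
  obtain ⟨e1, e2, e3⟩ := h.regularize.eventuallyEq_of_analyticAt h'.regularize a1 a2 a3 a1' a2' a3'
    (b1.trans b1'.symm) (b2.trans b2'.symm) (b3.trans b3'.symm)
  exact ⟨(regularize_eventuallyEq h.meromorphic_s).symm.trans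
      (e1.trans (regularize_eventuallyEq h'.meromorphic_s)),
    (regularize_eventuallyEq h.meromorphic_c).symm.trans
      (e2.trans (regularize_eventuallyEq h'.meromorphic_c)),
    (regularize_eventuallyEq h.meromorphic_d).symm.trans
      (e3.trans (regularize_eventuallyEq h'.meromorphic_d))⟩

/-! ### The Jacobi functions -/

/-- Differentiating the quadratic relation gives the derivatives of `cn` and `dn` from that of `sn`,
so a single Wronskian suffices. -/
theorem hasDerivAt_of_sq_add_mul_sq {f s : ℂ → ℂ} {b s' z : ℂ} (hf : DifferentiableAt ℂ f z)
    (hs : HasDerivAt s s' z) (h : ∀ᶠ w in 𝓝 z, f w ^ 2 + b * s w ^ 2 = 1) (h0 : f z ≠ 0) :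
    HasDerivAt f (-(b * s z * s' / f z)) z := by
  have h1 := (hf.hasDerivAt.pow 2).add ((hs.pow 2).const_mul b)
  have h2 : HasDerivAt (fun w => f w ^ 2 + b * s w ^ 2) 0 z :=
    (hasDerivAt_const z (1 : ℂ)).congr_of_eventuallyEq h
  have h3 := h1.unique h2
  convert! hf.hasDerivAt using 1
  field_simp
  simp at h3
  linear_combination -h3 / 2

theorem sq_add_sq_modulus {τ : ℂ} (hτ : 0 < τ.im) : modulus τ ^ 2 + comodulus τ ^ 2 = 1 := by
  obtain ⟨h2, h3, h4⟩ := theta_zero_ne_zero hτ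
  rw [modulus, comodulus]
  field_simp
  linear_combination theta_zero_pow_four hτ

theorem jacobiTriple_theta {τ : ℂ} (hτ : 0 < τ.im) : JacobiTriple (modulus τ ^ 2)
    (fun z => theta3 0 τ / theta2 0 τ *
      (theta1 (z / theta3 0 τ ^ 2) τ / theta4 (z / theta3 0 τ ^ 2) τ))
    (fun z => theta4 0 τ / theta2 0 τ *
      (theta2 (z / theta3 0 τ ^ 2) τ / theta4 (z / theta3 0 τ ^ 2) τ))
    (fun z => theta4 0 τ / theta3 0 τ *
      (theta3 (z / theta3 0 τ ^ 2) τ / theta4 (z / theta3 0 τ ^ 2) τ)) := by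
  obtain ⟨h2, h3, h4⟩ := theta_zero_ne_zero hτ
  have D1 : Differentiable ℂ fun z => theta1 (z / theta3 0 τ ^ 2) τ :=
    (differentiable_theta1 hτ).comp (differentiable_id.div_const _)
  have D2 : Differentiable ℂ fun z => theta2 (z / theta3 0 τ ^ 2) τ :=
    (differentiable_theta2 hτ).comp (differentiable_id.div_const _)
  have D3 : Differentiable ℂ fun z => theta3 (z / theta3 0 τ ^ 2) τ :=
    (differentiable_theta3 hτ).comp (differentiable_id.div_const _)
  have D4 : Differentiable ℂ fun z => theta4 (z / theta3 0 τ ^ 2) τ :=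
    (differentiable_theta4 hτ).comp (differentiable_id.div_const _)
  have mero {f : ℂ → ℂ} (hf : Differentiable ℂ f) : Meromorphic f :=
    fun x => (hf.analyticAt x).meromorphicAt
  have ne {f : ℂ → ℂ} (hf : Differentiable ℂ f) (h0 : f 0 ≠ 0) :
      ∀ᶠ z in codiscrete ℂ, f z ≠ 0 :=
    AnalyticOnNhd.preimage_zero_mem_codiscrete (fun x _ => hf.analyticAt x) h0
  have N2 := ne D2 (by simpa using h2)
  have N3 := ne D3 (by simpa using h3)
  have N4 := ne D4 (by simpa using h4)
  have Rs (z : ℂ) (hz : theta4 (z / theta3 0 τ ^ 2) τ ≠ 0) :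
      (theta4 0 τ / theta2 0 τ *
        (theta2 (z / theta3 0 τ ^ 2) τ / theta4 (z / theta3 0 τ ^ 2) τ)) ^ 2 +
      1 * (theta3 0 τ / theta2 0 τ *
        (theta1 (z / theta3 0 τ ^ 2) τ / theta4 (z / theta3 0 τ ^ 2) τ)) ^ 2 = 1 := by
    have := (theta_sq_relations hτ (z / theta3 0 τ ^ 2)).1
    set u := z / theta3 0 τ ^ 2
    field_simp
    linear_combination this
  have Rd (z : ℂ) (hz : theta4 (z / theta3 0 τ ^ 2) τ ≠ 0) :
      (theta4 0 τ / theta3 0 τ *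
        (theta3 (z / theta3 0 τ ^ 2) τ / theta4 (z / theta3 0 τ ^ 2) τ)) ^ 2 +
      modulus τ ^ 2 * (theta3 0 τ / theta2 0 τ *
        (theta1 (z / theta3 0 τ ^ 2) τ / theta4 (z / theta3 0 τ ^ 2) τ)) ^ 2 = 1 := by
    have := (theta_sq_relations hτ (z / theta3 0 τ ^ 2)).2
    rw [modulus]
    set u := z / theta3 0 τ ^ 2
    field_simp
    linear_combination this
  -- The normalization $u=z/\Theta_3(0)^2$ is what makes the constant in
  -- $\mathrm{sn}'=\mathrm{cn}\,\mathrm{dn}$ equal to $1$.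
  have Ds (z : ℂ) (hz : theta4 (z / theta3 0 τ ^ 2) τ ≠ 0) : HasDerivAt
      (fun z => theta3 0 τ / theta2 0 τ *
        (theta1 (z / theta3 0 τ ^ 2) τ / theta4 (z / theta3 0 τ ^ 2) τ))
      (theta4 0 τ / theta2 0 τ *
        (theta2 (z / theta3 0 τ ^ 2) τ / theta4 (z / theta3 0 τ ^ 2) τ) *
      (theta4 0 τ / theta3 0 τ *
        (theta3 (z / theta3 0 τ ^ 2) τ / theta4 (z / theta3 0 τ ^ 2) τ))) z := by
    have hu : HasDerivAt (fun z : ℂ => z / theta3 0 τ ^ 2) (1 / theta3 0 τ ^ 2) z :=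
      (hasDerivAt_id z).div_const _
    have e1 := (differentiable_theta1 hτ (z / theta3 0 τ ^ 2)).hasDerivAt.comp z hu
    have e4 := (differentiable_theta4 hτ (z / theta3 0 τ ^ 2)).hasDerivAt.comp z hu
    have hW := theta_wronskian hτ (z / theta3 0 τ ^ 2)
    convert! (e1.div e4 hz).const_mul (theta3 0 τ / theta2 0 τ) using 1
    simp only [Function.comp]
    set u := z / theta3 0 τ ^ 2
    field_simp
    linear_combination -hW
  have Op : ∀ z, theta4 (z / theta3 0 τ ^ 2) τ ≠ 0 →
      ∀ᶠ w in 𝓝 z, theta4 (w / theta3 0 τ ^ 2) τ ≠ 0 :=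
    fun z hz => (D4 z).continuousAt.eventually_ne hz
  have lim {f : ℂ → ℂ} (hf : Differentiable ℂ f) {a b : ℂ} (hab : a * (f 0 / theta4 0 τ) = b) :
      Tendsto (fun z => a * (f z / theta4 (z / theta3 0 τ ^ 2) τ)) (𝓝[≠] 0) (𝓝 b) := by
    have h := ((hf 0).continuousAt.div (D4 0).continuousAt (by simpa using h4)).const_mul a
    have h' := h.tendsto.mono_left (nhdsWithin_le_nhds (s := {0}ᶜ))
    simpa [← hab] using h'
  refine ⟨(Meromorphic.const _).mul ((mero D1).div (mero D4)),
    (Meromorphic.const _).mul ((mero D2).div (mero D4)),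
    (Meromorphic.const _).mul ((mero D3).div (mero D4)),
    lim D1 (by simp [theta1_zero]), lim D2 (by simp; field_simp), lim D3 (by simp; field_simp),
    N4.mono Ds, ?_, ?_, ?_, N4.mono Rd⟩
  · filter_upwards [N2, N4] with z n2 n4
    have := hasDerivAt_of_sq_add_mul_sq (((D2 z).div (D4 z) n4).const_mul _) (Ds z n4)
      ((Op z n4).mono Rs) (mul_ne_zero (div_ne_zero h4 h2) (div_ne_zero n2 n4))
    convert! this using 1
    simp only [Pi.div_apply]
    field_simp
  · filter_upwards [N3, N4] with z n3 n4
    have := hasDerivAt_of_sq_add_mul_sq (((D3 z).div (D4 z) n4).const_mul _) (Ds z n4)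
      ((Op z n4).mono Rd) (mul_ne_zero (div_ne_zero h4 h3) (div_ne_zero n3 n4))
    convert! this using 1
    simp only [Pi.div_apply]
    field_simp
  · exact N4.mono fun z hz => by linear_combination Rs z hz

theorem jacobiTriple_tau {τ : ℂ} (hτ : 0 < τ.im) :
    JacobiTriple (modulus τ ^ 2) (snTau τ) (cnTau τ) (dnTau τ) :=
  (jacobiTriple_theta hτ).regularize

theorem tauOf_spec {τ : ℂ} (hτ : 0 < τ.im) :
    0 < (tauOf (modulus τ)).im ∧ modulus (tauOf (modulus τ)) = modulus τ :=
  Classical.epsilon_spec (p := fun σ : ℂ => 0 < σ.im ∧ modulus σ = modulus τ) ⟨τ, hτ, rfl⟩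

theorem jacobiTriple_modulus {τ : ℂ} (hτ : 0 < τ.im) :
    JacobiTriple (modulus τ ^ 2) (sn (modulus τ)) (cn (modulus τ)) (dn (modulus τ)) := by
  obtain ⟨h1, h2⟩ := tauOf_spec hτ
  have := jacobiTriple_tau h1
  rwa [h2] at this

/-- Both triples solve the system with the same $k^2$, whatever $\tau$ was chosen. -/
theorem jacobi_modulus_eq_tau {τ : ℂ} (hτ : 0 < τ.im) :
    sn (modulus τ) = snTau τ ∧ cn (modulus τ) = cnTau τ ∧ dn (modulus τ) = dnTau τ := by
  obtain ⟨e1, e2, e3⟩ := (jacobiTriple_modulus hτ).eventuallyEq (jacobiTriple_tau hτ)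
  exact ⟨MeromorphicNFOn.eq_of_eventuallyEq (meromorphicNFOn_regularize _)
      (meromorphicNFOn_regularize _) e1,
    MeromorphicNFOn.eq_of_eventuallyEq (meromorphicNFOn_regularize _)
      (meromorphicNFOn_regularize _) e2,
    MeromorphicNFOn.eq_of_eventuallyEq (meromorphicNFOn_regularize _)
      (meromorphicNFOn_regularize _) e3⟩

/-! ### Modular transformations of the moduli -/

theorem nomePow_add_one (τ a : ℂ) : nomePow (τ + 1) a = exp (π * I * a) * nomePow τ a := by
  rw [nomePow, nomePow, ← exp_add]
  congr 1
  ring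

theorem exp_pi_mul_I_mul_sq (n : ℕ) : exp (π * I * ((n : ℂ) + 1) ^ 2) = (-1) ^ (n + 1) := by
  rw [show (π : ℂ) * I * ((n : ℂ) + 1) ^ 2 = ((n + 1) ^ 2 : ℕ) * (π * I) by push_cast; ring,
    exp_nat_mul, exp_pi_mul_I, pow_two, pow_mul]
  rcases neg_one_pow_eq_or ℂ (n + 1) with h | h <;> simp [h]

theorem theta3_zero_add_one (τ : ℂ) : theta3 0 (τ + 1) = theta4 0 τ := by
  simp only [theta3, theta4, nomePow_add_one, exp_pi_mul_I_mul_sq]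

theorem theta4_zero_add_one (τ : ℂ) : theta4 0 (τ + 1) = theta3 0 τ := by
  simp only [theta3, theta4, nomePow_add_one, exp_pi_mul_I_mul_sq, ← mul_assoc, ← pow_add,
    Even.neg_one_pow ⟨_, rfl⟩, one_mul]

theorem theta2_zero_add_one (τ : ℂ) : theta2 0 (τ + 1) = exp (π * I / 4) * theta2 0 τ := by
  -- $(n+1/2)^2=n(n+1)+1/4$, and $n(n+1)$ is even.
  have h (n : ℕ) : exp (π * I * ((n : ℂ) + 1 / 2) ^ 2) = exp (π * I / 4) := by
    rw [show (π : ℂ) * I * ((n : ℂ) + 1 / 2) ^ 2 = (n * (n + 1) : ℕ) * (π * I) + π * I / 4 by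
      push_cast; ring, exp_add, exp_nat_mul, exp_pi_mul_I, (Nat.even_mul_succ_self n).neg_one_pow,
      one_mul]
  simp only [theta2, nomePow_add_one, h]
  simp only [mul_assoc, tsum_mul_left]
  ring

theorem modulus_add_one {τ : ℂ} (hτ : 0 < τ.im) :
    modulus (τ + 1) = I * modulus τ / comodulus τ ∧ comodulus (τ + 1) = 1 / comodulus τ := by
  obtain ⟨h2, h3, h4⟩ := theta_zero_ne_zero hτ
  have hI : exp (π * I / 4) ^ 2 = I := by
    rw [← exp_nat_mul, show ((2 : ℕ) : ℂ) * (π * I / 4) = π / 2 * I by push_cast; ring,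
      exp_pi_div_two_mul_I]
  simp only [modulus, comodulus, theta2_zero_add_one, theta3_zero_add_one, theta4_zero_add_one,
    mul_pow, hI]
  constructor <;> field_simp

theorem im_neg_one_div_pos {τ : ℂ} (hτ : 0 < τ.im) : 0 < (-1 / τ).im := by
  have h0 : τ ≠ 0 := fun h => by simp [h] at hτ
  have : (-1 / τ).im = τ.im / normSq τ := by simp [neg_div]
  rw [this]
  exact div_pos hτ (normSq_pos.2 h0)

/-- The functional equation at $0$ and at $1/2$ relates $\Theta_3,\Theta_4$ at $\tau$ to
$\Theta_3,\Theta_2$ at $-1/\tau$ with a common factor, which cancels in the quotient. -/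
theorem modulus_neg_one_div_eq_comodulus {τ : ℂ} (hτ : 0 < τ.im) :
    modulus (-1 / τ) = comodulus τ := by
  have h0 : τ ≠ 0 := fun h => by simp [h] at hτ
  have hσ := im_neg_one_div_pos hτ
  have hC : (1 / (-I * τ) ^ (1 / 2 : ℂ)) ≠ 0 := by
    refine one_div_ne_zero ?_
    rw [Ne, cpow_eq_zero_iff]
    simp [h0]
  have e3 := jacobiTheta₂_functional_equation 0 τ
  have e4 := jacobiTheta₂_functional_equation (1 / 2) τ
  have f3 : theta3 0 τ = 1 / (-I * τ) ^ (1 / 2 : ℂ) * theta3 0 (-1 / τ) := by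
    rw [theta3_eq hτ, theta3_eq hσ]
    simpa using e3
  have f4 : theta4 0 τ = 1 / (-I * τ) ^ (1 / 2 : ℂ) * theta2 0 (-1 / τ) := by
    rw [theta4_eq hτ, theta2_eq hσ, zero_div, zero_add, zero_add, mul_zero, add_zero, e4,
      ← jacobiTheta₂_neg_left (1 / 2 / τ), mul_assoc, show -(1 / 2 / τ) = -1 / τ / 2 by ring,
      show -(π : ℂ) * I * (1 / 2) ^ 2 / τ = π * I * (-1 / τ) / 4 by ring]
  rw [modulus, comodulus, f3, f4, mul_pow, mul_pow, mul_div_mul_left _ _ (pow_ne_zero 2 hC)]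

theorem comodulus_neg_one_div {τ : ℂ} (hτ : 0 < τ.im) : comodulus (-1 / τ) = modulus τ := by
  have h0 : τ ≠ 0 := fun h => by simp [h] at hτ
  rw [← modulus_neg_one_div_eq_comodulus (im_neg_one_div_pos hτ)]
  congr 1
  field_simp

theorem modulus_ne_zero {τ : ℂ} (hτ : 0 < τ.im) : modulus τ ≠ 0 := by
  obtain ⟨h2, h3, h4⟩ := theta_zero_ne_zero hτ
  exact div_ne_zero (pow_ne_zero 2 h2) (pow_ne_zero 2 h3)

theorem comodulus_ne_zero {τ : ℂ} (hτ : 0 < τ.im) : comodulus τ ≠ 0 := by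
  obtain ⟨h2, h3, h4⟩ := theta_zero_ne_zero hτ
  exact div_ne_zero (pow_ne_zero 2 h4) (pow_ne_zero 2 h3)

/-! ### Transformations of the solutions -/

theorem tendsto_const_mul_nhdsNE_zero {a : ℂ} (ha : a ≠ 0) :
    Tendsto (fun z => a * z) (𝓝[≠] 0) (𝓝[≠] 0) := by
  refine tendsto_nhdsWithin_iff.2
    ⟨?_, eventually_mem_nhdsWithin.mono fun z hz => mul_ne_zero ha (by simpa using hz)⟩
  simpa using ((continuous_const_mul a).tendsto 0).mono_left nhdsWithin_le_nhds

theorem eventually_hasDerivAt_comp_const_mul {f f' : ℂ → ℂ} {a : ℂ} (ha : a ≠ 0)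
    (h : ∀ᶠ z in codiscrete ℂ, HasDerivAt f (f' z) z) :
    ∀ᶠ z in codiscrete ℂ, HasDerivAt (fun z => f (a * z)) (f' (a * z) * a) z := by
  filter_upwards [(tendsto_const_mul_codiscrete ha).eventually h] with z hz
  have hl : HasDerivAt (fun z => a * z) a z := by simpa using (hasDerivAt_id z).const_mul a
  exact HasDerivAt.comp z hz hl

namespace JacobiTriple

variable {m : ℂ} {s c d : ℂ → ℂ}

/-- Jacobi's imaginary transformation. -/
theorem imaginary (h : JacobiTriple m s c d) : JacobiTriple (1 - m)
    (fun z => I * (s (-I * z) / c (-I * z))) (fun z => 1 / c (-I * z))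
    (fun z => d (-I * z) / c (-I * z)) := by
  have hI : -I ≠ 0 := neg_ne_zero.2 I_ne_zero
  have T := tendsto_const_mul_codiscrete hI
  have T0 := tendsto_const_mul_nhdsNE_zero hI
  have ds := eventually_hasDerivAt_comp_const_mul hI h.deriv_s
  have dc := eventually_hasDerivAt_comp_const_mul hI h.deriv_c
  have dd := eventually_hasDerivAt_comp_const_mul hI h.deriv_d
  have nc := T.eventually h.c_ne_zero
  have q1 := T.eventually h.sq_s_add_sq_c
  have q2 := T.eventually h.sq_d_add_sq_s
  have ms := meromorphic_comp_const_mul h.meromorphic_s (-I)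
  have mc := meromorphic_comp_const_mul h.meromorphic_c (-I)
  have md := meromorphic_comp_const_mul h.meromorphic_d (-I)
  have ts := h.tendsto_s.comp T0
  have tc := h.tendsto_c.comp T0
  have td := h.tendsto_d.comp T0
  refine ⟨(Meromorphic.const _).mul (ms.div mc), (Meromorphic.const _).div mc, md.div mc,
    by simpa [Function.comp_def] using (ts.div tc one_ne_zero).const_mul I,
    (by
      have := (tendsto_const_nhds (x := (1 : ℂ))).div tc one_ne_zero
      rwa [div_one] at this),
    (by have := td.div tc one_ne_zero; rwa [div_one] at this), ?_, ?_, ?_, ?_, ?_⟩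
  · filter_upwards [ds, dc, nc, q1] with z ds dc nc q1
    convert! (ds.div dc nc).const_mul I using 1
    -- What remains is a polynomial identity modulo the two quadratic relations and $i^2=-1$.
    generalize -I * z = w at *
    field_simp
    linear_combination -d w * q1 + d w * (s w ^ 2 + c w ^ 2) * I_sq
  · filter_upwards [dc, nc] with z dc nc
    convert! (hasDerivAt_const z (1 : ℂ)).div dc nc using 1
    generalize -I * z = w at *
    field_simp
    ring
  · filter_upwards [dc, dd, nc, q1, q2] with z dc dd nc q1 q2
    convert! dd.div dc nc using 1
    generalize -I * z = w at *
    field_simp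
    linear_combination s w * (q2 - m * q1)
  · filter_upwards [nc, q1] with z nc q1
    generalize -I * z = w at *
    field_simp
    linear_combination -q1 + s w ^ 2 * I_sq
  · filter_upwards [nc, q1, q2] with z nc q1 q2
    generalize -I * z = w at *
    field_simp
    linear_combination q2 - q1 + (1 - m) * s w ^ 2 * I_sq

/-- The transformation that corresponds to a unit translation of the period. -/
theorem translate (h : JacobiTriple m s c d) {k : ℂ} (hk : k ≠ 0) (hm : k ^ 2 = 1 - m) :
    JacobiTriple (-m / k ^ 2) (fun z => k * (s (k⁻¹ * z) / d (k⁻¹ * z)))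
      (fun z => c (k⁻¹ * z) / d (k⁻¹ * z)) (fun z => 1 / d (k⁻¹ * z)) := by
  have hI : k⁻¹ ≠ 0 := inv_ne_zero hk
  have T := tendsto_const_mul_codiscrete hI
  have T0 := tendsto_const_mul_nhdsNE_zero hI
  have ds := eventually_hasDerivAt_comp_const_mul hI h.deriv_s
  have dc := eventually_hasDerivAt_comp_const_mul hI h.deriv_c
  have dd := eventually_hasDerivAt_comp_const_mul hI h.deriv_d
  have nd := T.eventually h.d_ne_zero
  have q1 := T.eventually h.sq_s_add_sq_c
  have q2 := T.eventually h.sq_d_add_sq_s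
  have ms := meromorphic_comp_const_mul h.meromorphic_s k⁻¹
  have mc := meromorphic_comp_const_mul h.meromorphic_c k⁻¹
  have md := meromorphic_comp_const_mul h.meromorphic_d k⁻¹
  have ts := h.tendsto_s.comp T0
  have tc := h.tendsto_c.comp T0
  have td := h.tendsto_d.comp T0
  refine ⟨(Meromorphic.const _).mul (ms.div md), mc.div md, (Meromorphic.const _).div md,
    by simpa using (ts.div td one_ne_zero).const_mul k,
    (by have := tc.div td one_ne_zero; rwa [div_one] at this),
    (by
      have := (tendsto_const_nhds (x := (1 : ℂ))).div td one_ne_zero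
      rwa [div_one] at this), ?_, ?_, ?_, ?_, ?_⟩
  · filter_upwards [ds, dd, nd, q2] with z ds dd nd q2
    convert! (ds.div dd nd).const_mul k using 1
    generalize k⁻¹ * z = w at *
    field_simp
    linear_combination -c w * q2
  · filter_upwards [dc, dd, nd, q1, q2] with z dc dd nd q1 q2
    convert! dc.div dd nd using 1
    generalize k⁻¹ * z = w at *
    field_simp
    linear_combination s w * (q2 - m * q1 - hm)
  · filter_upwards [dd, nd] with z dd nd
    convert! (hasDerivAt_const z (1 : ℂ)).div dd nd using 1
    generalize k⁻¹ * z = w at *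
    field_simp
    ring
  · filter_upwards [nd, q1, q2] with z nd q1 q2
    generalize k⁻¹ * z = w at *
    field_simp
    linear_combination q1 - q2 + s w ^ 2 * hm
  · filter_upwards [nd, q1, q2] with z nd q1 q2
    generalize k⁻¹ * z = w at *
    field_simp
    linear_combination -q2

end JacobiTriple

/-! ### Transformations of the Jacobi functions -/

theorem eventually_quotients (k : ℂ) : ∀ᶠ z in codiscrete ℂ,
    (ns k z = 1 / sn k z ∧ nc k z = 1 / cn k z ∧ nd k z = 1 / dn k z) ∧
    (sc k z = sn k z / cn k z ∧ sd k z = sn k z / dn k z ∧ cd k z = cn k z / dn k z) ∧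
    cs k z = cn k z / sn k z ∧ ds k z = dn k z / sn k z ∧ dc k z = dn k z / cn k z := by
  have ms : Meromorphic (sn k) := meromorphic_regularize _
  have mc : Meromorphic (cn k) := meromorphic_regularize _
  have md : Meromorphic (dn k) := meromorphic_regularize _
  have m1 : Meromorphic fun _ : ℂ => (1 : ℂ) := Meromorphic.const 1
  filter_upwards [regularize_eventuallyEq (m1.div ms), regularize_eventuallyEq (m1.div mc),
    regularize_eventuallyEq (m1.div md), regularize_eventuallyEq (ms.div mc),
    regularize_eventuallyEq (ms.div md), regularize_eventuallyEq (mc.div md),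
    regularize_eventuallyEq (mc.div ms), regularize_eventuallyEq (md.div ms),
    regularize_eventuallyEq (md.div mc)] with z h1 h2 h3 h4 h5 h6 h7 h8 h9
  exact ⟨⟨h1, h2, h3⟩, ⟨h4, h5, h6⟩, h7, h8, h9⟩

theorem eq_const_mul_comp_const_mul {f g : ℂ → ℂ} {a b : ℂ} (hf : MeromorphicNFOn f Set.univ)
    (hg : MeromorphicNFOn g Set.univ) (ha : a ≠ 0)
    (h : ∀ᶠ z in codiscrete ℂ, f z = a * g (b * z)) (z : ℂ) : f z = a * g (b * z) :=
  congrFun (MeromorphicNFOn.eq_of_eventuallyEq hf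
    (MeromorphicNFOn.const_mul (MeromorphicNFOn.comp_const_mul hg b) ha) h) z

theorem eq_comp_const_mul {f g : ℂ → ℂ} {b : ℂ} (hf : MeromorphicNFOn f Set.univ)
    (hg : MeromorphicNFOn g Set.univ)
    (h : ∀ᶠ z in codiscrete ℂ, f z = g (b * z)) (z : ℂ) : f z = g (b * z) :=
  congrFun (MeromorphicNFOn.eq_of_eventuallyEq hf (MeromorphicNFOn.comp_const_mul hg b) h) z

theorem jacobiTriple_comodulus {τ : ℂ} (hτ : 0 < τ.im) : JacobiTriple (comodulus τ ^ 2)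
    (sn (comodulus τ)) (cn (comodulus τ)) (dn (comodulus τ)) := by
  have := jacobiTriple_modulus (im_neg_one_div_pos hτ)
  rwa [modulus_neg_one_div_eq_comodulus hτ] at this

/-- The imaginary transformation of the triple of modulus $k'$ solves the system for $1-k'^2=k^2$,
hence is the triple of modulus $k$. The twelve formulas are quotients of the resulting three, taken
at $iz$. -/
theorem jacobi_imaginary {τ k k' : ℂ} (hτ : 0 < τ.im) (hk : k = modulus τ)
    (hk' : k' = comodulus τ) (z : ℂ) :
    sc k' z = -I * sn k (I * z) ∧ nc k' z = cn k (I * z) ∧ dc k' z = dn k (I * z) ∧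
    cs k' z = I * ns k (I * z) ∧ ds k' z = I * ds k (I * z) ∧ ns k' z = I * cs k (I * z) ∧
    nd k' z = cd k (I * z) ∧ cd k' z = nd k (I * z) ∧ sd k' z = -I * sd k (I * z) ∧
    cn k' z = nc k (I * z) ∧ sn k' z = -I * sc k (I * z) ∧ dn k' z = dc k (I * z) := by
  have h' := jacobiTriple_comodulus hτ
  have h := jacobiTriple_modulus hτ
  have hq := sq_add_sq_modulus hτ
  rw [← hk, ← hk'] at hq
  rw [← hk] at h
  rw [← hk'] at h'
  have hi := h'.imaginary
  rw [show 1 - k' ^ 2 = k ^ 2 by linear_combination -hq] at hi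
  obtain ⟨e1, e2, e3⟩ := h.eventuallyEq hi
  have T := tendsto_const_mul_codiscrete I_ne_zero
  have hI (z : ℂ) : -I * (I * z) = z := by linear_combination -z * I_sq
  have key : ∀ᶠ z in codiscrete ℂ,
      (sc k' z = -I * sn k (I * z) ∧ nc k' z = cn k (I * z) ∧ dc k' z = dn k (I * z) ∧
      cs k' z = I * ns k (I * z) ∧ ds k' z = I * ds k (I * z) ∧ ns k' z = I * cs k (I * z)) ∧
      nd k' z = cd k (I * z) ∧ cd k' z = nd k (I * z) ∧ sd k' z = -I * sd k (I * z) ∧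
      cn k' z = nc k (I * z) ∧ sn k' z = -I * sc k (I * z) ∧ dn k' z = dc k (I * z) := by
    filter_upwards [T.eventually e1, T.eventually e2, T.eventually e3, eventually_quotients k',
      T.eventually (eventually_quotients k), h'.s_ne_zero, h'.c_ne_zero, h'.d_ne_zero]
      with z e1 e2 e3 q' q ns nc nd
    simp only [hI] at e1 e2 e3
    obtain ⟨⟨p1, p2, p3⟩, ⟨p4, p5, p6⟩, p7, p8, p9⟩ := q'
    obtain ⟨⟨r1, r2, r3⟩, ⟨r4, r5, r6⟩, r7, r8, r9⟩ := q
    simp only [p1, p2, p3, p4, p5, p6, p7, p8, p9, r1, r2, r3, r4, r5, r6, r7, r8, r9, e1, e2, e3]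
    generalize sn k' z = s at *
    generalize cn k' z = c at *
    generalize dn k' z = d at *
    have := I_ne_zero
    refine ⟨⟨?_, ?_, ?_, ?_, ?_, ?_⟩, ?_, ?_, ?_, ?_, ?_, ?_⟩ <;>
      first | trivial | (field_simp; done) | (field_simp; simp)
  have hI' : -I ≠ 0 := neg_ne_zero.2 I_ne_zero
  have N := meromorphicNFOn_regularize
  exact ⟨eq_const_mul_comp_const_mul (N _) (N _) hI' (key.mono fun z hz => hz.1.1) z,
    eq_comp_const_mul (N _) (N _) (key.mono fun z hz => hz.1.2.1) z,
    eq_comp_const_mul (N _) (N _) (key.mono fun z hz => hz.1.2.2.1) z,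
    eq_const_mul_comp_const_mul (N _) (N _) I_ne_zero (key.mono fun z hz => hz.1.2.2.2.1) z,
    eq_const_mul_comp_const_mul (N _) (N _) I_ne_zero (key.mono fun z hz => hz.1.2.2.2.2.1) z,
    eq_const_mul_comp_const_mul (N _) (N _) I_ne_zero (key.mono fun z hz => hz.1.2.2.2.2.2) z,
    eq_comp_const_mul (N _) (N _) (key.mono fun z hz => hz.2.1) z,
    eq_comp_const_mul (N _) (N _) (key.mono fun z hz => hz.2.2.1) z,
    eq_const_mul_comp_const_mul (N _) (N _) hI' (key.mono fun z hz => hz.2.2.2.1) z,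
    eq_comp_const_mul (N _) (N _) (key.mono fun z hz => hz.2.2.2.2.1) z,
    eq_const_mul_comp_const_mul (N _) (N _) hI' (key.mono fun z hz => hz.2.2.2.2.2.1) z,
    eq_comp_const_mul (N _) (N _) (key.mono fun z hz => hz.2.2.2.2.2.2) z⟩

/-- The translated triple solves the system for $-k^2/k'^2=\lambda^2$, and $\lambda$ is itself a
modulus, that of $\tau+1$. -/
theorem jacobi_translate {τ k k' l : ℂ} (hτ : 0 < τ.im) (hk : k = modulus τ)
    (hk' : k' = comodulus τ) (hl : l = I * k / k') (z : ℂ) :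
    sd k z = sn l (k' * z) / k' ∧ cd k z = cn l (k' * z) ∧ nd k z = dn l (k' * z) := by
  have hτ1 : 0 < (τ + 1).im := by simpa using hτ
  have hk0 : k' ≠ 0 := hk' ▸ comodulus_ne_zero hτ
  have h' := jacobiTriple_modulus hτ1
  have h := jacobiTriple_modulus hτ
  have hq := sq_add_sq_modulus hτ
  rw [← hk, ← hk'] at hq
  rw [← hk] at h
  rw [(modulus_add_one hτ).1, ← hk, ← hk', ← hl] at h'
  have ht := h.translate hk0 (by linear_combination hq)
  rw [show -k ^ 2 / k' ^ 2 = l ^ 2 by rw [hl, div_pow, mul_pow, I_sq, neg_one_mul]] at ht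
  obtain ⟨e1, e2, e3⟩ := h'.eventuallyEq ht
  have T := tendsto_const_mul_codiscrete hk0
  have key : ∀ᶠ z in codiscrete ℂ,
      sd k z = k'⁻¹ * sn l (k' * z) ∧ cd k z = cn l (k' * z) ∧ nd k z = dn l (k' * z) := by
    filter_upwards [T.eventually e1, T.eventually e2, T.eventually e3, eventually_quotients k]
      with z e1 e2 e3 q
    simp only [inv_mul_cancel_left₀ hk0] at e1 e2 e3
    obtain ⟨⟨p1, p2, p3⟩, ⟨p4, p5, p6⟩, p7, p8, p9⟩ := q
    refine ⟨?_, ?_, ?_⟩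
    · rw [p5, e1, inv_mul_cancel_left₀ hk0]
    · rw [p6, e2]
    · rw [p3, e3]
  have N := meromorphicNFOn_regularize
  rw [div_eq_inv_mul]
  exact ⟨eq_const_mul_comp_const_mul (N _) (N _) (inv_ne_zero hk0) (key.mono fun z hz => hz.1) z,
    eq_comp_const_mul (N _) (N _) (key.mono fun z hz => hz.2.1) z,
    eq_comp_const_mul (N _) (N _) (key.mono fun z hz => hz.2.2) z⟩

/-! ### Moduli on the imaginary axis -/

theorem nomePow_I_mul (t a : ℝ) : nomePow (I * t) a = (Real.exp (-(π * t * a)) : ℝ) := by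
  rw [nomePow, ofReal_exp]
  congr 1
  push_cast
  linear_combination (π * t * a : ℂ) * I_sq

theorem theta2_zero_I_mul (t : ℝ) : ∃ r : ℝ, theta2 0 (I * t) = r := by
  refine ⟨2 * ∑' n : ℕ, Real.exp (-(π * t * ((n : ℝ) + 1 / 2) ^ 2)), ?_⟩
  rw [theta2, ofReal_mul, ofReal_tsum, ofReal_ofNat]
  congr 2
  funext n
  rw [mul_zero, Complex.cos_zero, mul_one, ← nomePow_I_mul]
  push_cast
  rfl

theorem theta3_zero_I_mul (t : ℝ) : ∃ r : ℝ, theta3 0 (I * t) = r := by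
  refine ⟨1 + 2 * ∑' n : ℕ, Real.exp (-(π * t * ((n : ℝ) + 1) ^ 2)), ?_⟩
  rw [theta3, ofReal_add, ofReal_one, ofReal_mul, ofReal_tsum, ofReal_ofNat]
  congr 3
  funext n
  rw [mul_zero, Complex.cos_zero, mul_one, ← nomePow_I_mul]
  push_cast
  rfl

theorem theta4_zero_I_mul (t : ℝ) : ∃ r : ℝ, theta4 0 (I * t) = r := by
  refine ⟨1 + 2 * ∑' n : ℕ, (-1) ^ (n + 1) * Real.exp (-(π * t * ((n : ℝ) + 1) ^ 2)), ?_⟩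
  rw [theta4, ofReal_add, ofReal_one, ofReal_mul, ofReal_tsum, ofReal_ofNat]
  congr 3
  funext n
  rw [mul_zero, Complex.cos_zero, mul_one, ofReal_mul, ← nomePow_I_mul]
  push_cast
  rfl

theorem modulus_I_mul (t : ℝ) : ∃ r : ℝ, modulus (I * t) = r := by
  obtain ⟨a, ha⟩ := theta2_zero_I_mul t
  obtain ⟨b, hb⟩ := theta3_zero_I_mul t
  exact ⟨a ^ 2 / b ^ 2, by rw [modulus, ha, hb]; push_cast; rfl⟩

/-- Nonnegativity later selects the root $\sqrt{1-k^2}$ of $k'^2=1-k^2$. -/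
theorem comodulus_I_mul (t : ℝ) : ∃ r : ℝ, 0 ≤ r ∧ comodulus (I * t) = r := by
  obtain ⟨a, ha⟩ := theta4_zero_I_mul t
  obtain ⟨b, hb⟩ := theta3_zero_I_mul t
  exact ⟨a ^ 2 / b ^ 2, by positivity, by rw [comodulus, ha, hb]; push_cast; rfl⟩

theorem continuousAt_modulus {τ : ℂ} (hτ : 0 < τ.im) : ContinuousAt modulus τ := by
  have hev : ∀ᶠ σ : ℂ in 𝓝 τ, 0 < σ.im :=
    (continuous_im.isOpen_preimage _ isOpen_Ioi).mem_nhds hτ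
  have c2 : ContinuousAt (fun σ => theta2 0 σ) τ := by
    have h : ContinuousAt (fun σ : ℂ => jacobiTheta₂ (0 / π + σ / 2) σ) τ :=
      ContinuousAt.comp (f := fun σ : ℂ => ((0 : ℂ) / π + σ / 2, σ))
        (continuousAt_jacobiTheta₂ _ hτ) (by fun_prop)
    have h' : ContinuousAt (fun σ : ℂ => exp (π * I * σ / 4 + I * 0)) τ := by fun_prop
    exact (h'.mul h).congr (hev.mono fun σ hσ => (theta2_eq hσ 0).symm)
  have c3 : ContinuousAt (fun σ => theta3 0 σ) τ := by
    have h : ContinuousAt (fun σ : ℂ => jacobiTheta₂ (0 / π) σ) τ :=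
      ContinuousAt.comp (f := fun σ : ℂ => ((0 : ℂ) / π, σ))
        (continuousAt_jacobiTheta₂ _ hτ) (by fun_prop)
    exact h.congr (hev.mono fun σ hσ => (theta3_eq hσ 0).symm)
  exact (c2.pow 2).div (c3.pow 2) (pow_ne_zero 2 (theta_zero_ne_zero hτ).2.1)

theorem tendsto_modulus : Tendsto modulus (comap Complex.im atTop) (𝓝 0) := by
  have h1 : Tendsto (fun τ : ℂ => exp (π * I * τ / 4)) (comap Complex.im atTop) (𝓝 0) := by
    rw [tendsto_zero_iff_norm_tendsto_zero]
    have (τ : ℂ) : ‖exp (π * I * τ / 4)‖ = Real.exp (-(π / 4) * τ.im) := by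
      rw [Complex.norm_exp, show (π : ℂ) * I * τ / 4 = ((π / 4 : ℝ) : ℂ) * (I * τ) by
        push_cast; ring, re_ofReal_mul]
      simp
    simp only [this]
    exact Real.tendsto_exp_atBot.comp
      (tendsto_comap.const_mul_atTop_of_neg (by linarith [Real.pi_pos]))
  have h2 : Tendsto (fun τ : ℂ => theta2 0 τ) (comap Complex.im atTop) (𝓝 0) := by
    have := h1.mul tendsto_theta2_zero
    simp only [← mul_assoc, ← exp_add, add_neg_cancel, exp_zero, one_mul, zero_mul] at this
    exact this
  have := (h2.pow 2).div (tendsto_theta3_zero.pow 2) (by norm_num)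
  norm_num at this
  exact this

theorem tendsto_comodulus : Tendsto comodulus (comap Complex.im atTop) (𝓝 1) := by
  have := (tendsto_theta4_zero.pow 2).div (tendsto_theta3_zero.pow 2) (by norm_num)
  norm_num at this
  exact this

/-- On the imaginary axis $k(it)$ is real and continuous. It tends to $0$ as $t\to\infty$, while
$k(i/t)=k'(it)$ tends to $1$. -/
theorem exists_modulus_I_mul_eq {k : ℝ} (h0 : 0 < k) (h1 : k < 1) : ∃ t : ℝ, 0 < t ∧
    modulus (I * t) = k ∧ comodulus (I * t) = (√(1 - k ^ 2) : ℝ) := by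
  have hpos {t : ℝ} (ht : 0 < t) : 0 < (I * (t : ℂ)).im := by simpa using ht
  have hlim : Tendsto (fun t : ℝ => I * (t : ℂ)) atTop (comap Complex.im atTop) := by
    rw [tendsto_comap_iff]
    exact tendsto_id.congr fun t => by simp
  have hlow := ((continuous_re.tendsto _).comp (tendsto_modulus.comp hlim)).eventually_lt_const
    (show (0 : ℂ).re < k from h0)
  have hup := ((continuous_re.tendsto _).comp (tendsto_comodulus.comp hlim)).eventually_const_lt
    (show k < (1 : ℂ).re from h1)
  obtain ⟨a, ha, ha0⟩ := (hlow.and (eventually_gt_atTop 0)).exists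
  obtain ⟨b, hb, hb0⟩ := (hup.and (eventually_gt_atTop 0)).exists
  have hcont : ContinuousOn (fun t : ℝ => (modulus (I * t)).re) (Set.Ioi 0) := fun t ht =>
    (continuous_re.continuousAt.comp (ContinuousAt.comp (f := fun t : ℝ => I * (t : ℂ))
      (continuousAt_modulus (hpos ht)) (by fun_prop))).continuousWithinAt
  have hb' : k < (modulus (I * ((b⁻¹ : ℝ) : ℂ))).re := by
    have hb1 : (b : ℂ) ≠ 0 := by exact_mod_cast hb0.ne'
    rw [show I * ((b⁻¹ : ℝ) : ℂ) = -1 / (I * b) by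
      push_cast; field_simp; rw [I_sq], modulus_neg_one_div_eq_comodulus (hpos hb0)]
    exact hb
  obtain ⟨t, ht, hkt⟩ := isPreconnected_Ioi.intermediate_value (Set.mem_Ioi.2 ha0)
    (Set.mem_Ioi.2 (inv_pos.2 hb0)) hcont ⟨le_of_lt ha, le_of_lt hb'⟩
  obtain ⟨r, hr⟩ := modulus_I_mul t
  obtain ⟨r', hr0, hr'⟩ := comodulus_I_mul t
  have hk : modulus (I * t) = k := by
    simp only [hr, ofReal_re] at hkt
    rw [hr, hkt]
  refine ⟨t, ht, hk, ?_⟩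
  have hq := sq_add_sq_modulus (hpos ht)
  rw [hk, hr'] at hq
  have hq' : k ^ 2 + r' ^ 2 = 1 := by exact_mod_cast hq
  rw [hr', ← Real.sqrt_sq hr0, show r' ^ 2 = 1 - k ^ 2 by linarith]

/-! ### Realizations from brackets of meromorphic functions -/

/-- Meromorphic functions with `[X, Y] = a Z`, `[Y, Z] = b X`, `[Z, X] = c Y`. -/
structure BracketTriple (X Y Z : ℂ → ℂ) (a b c : ℂ) : Prop where
  meromorphic_X : Meromorphic X
  meromorphic_Y : Meromorphic Y
  meromorphic_Z : Meromorphic Z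
  X_ne_zero : ∀ᶠ z in codiscrete ℂ, X z ≠ 0
  Y_ne_zero : ∀ᶠ z in codiscrete ℂ, Y z ≠ 0
  Z_ne_zero : ∀ᶠ z in codiscrete ℂ, Z z ≠ 0
  bracket_X_Y : ∀ᶠ z in codiscrete ℂ, wittBracket X Y z = a * Z z
  bracket_Y_Z : ∀ᶠ z in codiscrete ℂ, wittBracket Y Z z = b * X z
  bracket_Z_X : ∀ᶠ z in codiscrete ℂ, wittBracket Z X z = c * Y z

theorem wittBracket_swap (f g : ℂ → ℂ) (z : ℂ) : wittBracket f g z = -wittBracket g f z := by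
  simp only [wittBracket]
  ring

theorem wittBracket_const_mul (a b : ℂ) (f g : ℂ → ℂ) (z : ℂ) :
    wittBracket (fun z => a * f z) (fun z => b * g z) z = a * b * wittBracket f g z := by
  simp only [wittBracket, deriv_const_mul_field]
  ring

theorem eventually_differentiableAt {f : ℂ → ℂ} (hf : Meromorphic f) :
    ∀ᶠ z in codiscrete ℂ, DifferentiableAt ℂ f z := by
  have h : ∀ᶠ z in codiscrete ℂ, AnalyticAt ℂ f z :=
    (hf.meromorphicOn (s := Set.univ)).analyticAt_mem_codiscreteWithin
  exact h.mono fun z hz => hz.differentiableAt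

theorem wittBracket_add_right {f g h : ℂ → ℂ} {a b z : ℂ} (hg : DifferentiableAt ℂ g z)
    (hh : DifferentiableAt ℂ h z) :
    wittBracket f (fun z => a * g z + b * h z) z =
      a * wittBracket f g z + b * wittBracket f h z := by
  have := ((hg.hasDerivAt.const_mul a).add (hh.hasDerivAt.const_mul b)).deriv
  have e : deriv (fun z => a * g z + b * h z) z = a * deriv g z + b * deriv h z := this
  simp only [wittBracket, e]
  ring

theorem wittBracket_eventuallyEq_zero {f g : ℂ → ℂ}
    (hg : ∀ᶠ z in codiscrete ℂ, g z = 0) : ∀ᶠ z in codiscrete ℂ, wittBracket f g z = 0 := by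
  filter_upwards [eventually_codiscrete_nhds hg] with z hz
  have h : HasDerivAt g 0 z := (hasDerivAt_const z (0 : ℂ)).congr_of_eventuallyEq hz
  rw [wittBracket, h.deriv, hz.self_of_nhds]
  ring

namespace BracketTriple

variable {X Y Z : ℂ → ℂ} {a b c : ℂ}

/-- Rotations and `swap` give all orders in which the three functions can serve as $J,P_1,P_2$. -/
theorem rotate (h : BracketTriple X Y Z a b c) : BracketTriple Y Z X b c a :=
  ⟨h.2, h.3, h.1, h.5, h.6, h.4, h.8, h.9, h.7⟩

theorem swap (h : BracketTriple X Y Z a b c) : BracketTriple Y X Z (-a) (-c) (-b) :=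
  ⟨h.2, h.1, h.3, h.5, h.4, h.6,
    h.bracket_X_Y.mono fun z hz => by rw [wittBracket_swap, hz]; ring,
    h.bracket_Z_X.mono fun z hz => by rw [wittBracket_swap, hz]; ring,
    h.bracket_Y_Z.mono fun z hz => by rw [wittBracket_swap, hz]; ring⟩

/-- Bracketing a linear relation with $X$ removes $p$ and leaves $qaZ-rcY=0$; bracketing this with
$Y$ and with $Z$ isolates $q$ and $r$. -/
theorem independent (h : BracketTriple X Y Z a b c) (ha : a ≠ 0) (hb : b ≠ 0) (hc : c ≠ 0)
    {p q r : ℂ} (h0 : ∀ᶠ z in codiscrete ℂ, p * X z + q * Y z + r * Z z = 0) :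
    p = 0 ∧ q = 0 ∧ r = 0 := by
  have dX := eventually_differentiableAt h.meromorphic_X
  have dY := eventually_differentiableAt h.meromorphic_Y
  have dZ := eventually_differentiableAt h.meromorphic_Z
  have h1 : ∀ᶠ z in codiscrete ℂ, (q * a) * Z z + (-(r * c)) * Y z = 0 := by
    filter_upwards [wittBracket_eventuallyEq_zero (f := X) h0, dX, dY, dZ, h.bracket_X_Y,
      h.bracket_Z_X] with z hz dX dY dZ b1 b2
    have d := ((dX.hasDerivAt.const_mul p).add (dY.hasDerivAt.const_mul q)).add
      (dZ.hasDerivAt.const_mul r)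
    have e : deriv (fun z => p * X z + q * Y z + r * Z z) z =
      p * deriv X z + q * deriv Y z + r * deriv Z z := d.deriv
    simp only [wittBracket, e] at hz b1 b2
    linear_combination hz - q * b1 + r * b2
  have hq : q * a * b = 0 := by
    have := (wittBracket_eventuallyEq_zero (f := Y) h1).and
      (((dY.and dZ).and h.bracket_Y_Z).and h.X_ne_zero)
    obtain ⟨z, hz, ⟨⟨dY, dZ⟩, b1⟩, ne⟩ := (eventually_nhdsNE_of_codiscrete this 0).exists
    rw [wittBracket_add_right dZ dY, b1] at hz
    simp only [wittBracket, mul_comm (Y z), sub_self, mul_zero, add_zero] at hz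
    exact (mul_eq_zero.1 (by linear_combination hz : q * a * b * X z = 0)).resolve_right ne
  have hr : r * c * b = 0 := by
    have := (wittBracket_eventuallyEq_zero (f := Z) h1).and
      (((dY.and dZ).and h.bracket_Y_Z).and h.X_ne_zero)
    obtain ⟨z, hz, ⟨⟨dY, dZ⟩, b1⟩, ne⟩ := (eventually_nhdsNE_of_codiscrete this 0).exists
    rw [wittBracket_add_right dZ dY, wittBracket_swap Z Y, b1] at hz
    simp only [wittBracket, mul_comm (Z z), sub_self, mul_zero, zero_add] at hz
    exact (mul_eq_zero.1 (by linear_combination hz : r * c * b * X z = 0)).resolve_right ne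
  have hq0 : q = 0 := by simpa [ha, hb] using hq
  have hr0 : r = 0 := by simpa [hc, hb] using hr
  obtain ⟨z, hz, ne⟩ := (eventually_nhdsNE_of_codiscrete (h0.and h.X_ne_zero) 0).exists
  refine ⟨?_, hq0, hr0⟩
  simpa [hq0, hr0, ne] using hz

/-- With $J=\alpha X$, $P_1=\beta Y$, $P_2=\gamma Z$ the bracket relations become three scalar
equations, which also force $a,b,c\ne0$ and thereby linear independence. -/
theorem isWittRealization (h : BracketTriple X Y Z a b c) (T : CKType) {α β γ : ℂ} {G : Generators}
    (hα : α ≠ 0) (hβ : β ≠ 0) (hγ : γ ≠ 0) (ha : α * β * a = γ)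
    (hb : β * γ * b = T.curv1 * α) (hc : γ * α * c = T.curv2 * β)
    (hJ : ∀ z, G.J z = α * X z) (h1 : ∀ z, G.P₁ z = β * Y z) (h2 : ∀ z, G.P₂ z = γ * Z z) :
    IsWittRealization T G := by
  obtain ⟨J, P₁, P₂⟩ := G
  obtain rfl : J = fun z => α * X z := funext hJ
  obtain rfl : P₁ = fun z => β * Y z := funext h1
  obtain rfl : P₂ = fun z => γ * Z z := funext h2
  have κ1 : T.curv1 ≠ 0 := by cases T <;> simp [CKType.curv1]
  have κ2 : T.curv2 ≠ 0 := by cases T <;> simp [CKType.curv2]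
  have ha0 : a ≠ 0 := right_ne_zero_of_mul (ha.trans_ne hγ)
  have hb0 : b ≠ 0 := right_ne_zero_of_mul (hb.trans_ne (mul_ne_zero κ1 hα))
  have hc0 : c ≠ 0 := right_ne_zero_of_mul (hc.trans_ne (mul_ne_zero κ2 hβ))
  refine ⟨(Meromorphic.const _).mul h.1, (Meromorphic.const _).mul h.2,
    (Meromorphic.const _).mul h.3, ?_, ?_, ?_, ?_⟩
  · filter_upwards [h.bracket_X_Y] with z hz
    rw [wittBracket_const_mul, hz]
    linear_combination Z z * ha
  · filter_upwards [h.bracket_Z_X] with z hz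
    rw [wittBracket_const_mul, wittBracket_swap, hz]
    linear_combination -Y z * hc
  · filter_upwards [h.bracket_Y_Z] with z hz
    rw [wittBracket_const_mul, hz]
    linear_combination X z * hb
  · intro p q r h0
    have := h.independent ha0 hb0 hc0 (p := p * α) (q := q * β) (r := r * γ)
      (h0.mono fun z hz => by linear_combination hz)
    simpa [hα, hβ, hγ] using this

theorem of_hasDerivAt (hX : Meromorphic X) (hY : Meromorphic Y) (hZ : Meromorphic Z)
    (nX : ∀ᶠ z in codiscrete ℂ, X z ≠ 0) (nY : ∀ᶠ z in codiscrete ℂ, Y z ≠ 0)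
    (nZ : ∀ᶠ z in codiscrete ℂ, Z z ≠ 0)
    (h : ∀ᶠ z in codiscrete ℂ, ∃ x y w : ℂ, HasDerivAt X x z ∧ HasDerivAt Y y z ∧
      HasDerivAt Z w z ∧ X z * y - Y z * x = a * Z z ∧ Y z * w - Z z * y = b * X z ∧
      Z z * x - X z * w = c * Y z) : BracketTriple X Y Z a b c := by
  refine ⟨hX, hY, hZ, nX, nY, nZ, h.mono ?_, h.mono ?_, h.mono ?_⟩ <;>
  · rintro z ⟨x, y, w, h1, h2, h3, e1, e2, e3⟩
    simpa only [wittBracket, h1.deriv, h2.deriv, h3.deriv]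

end BracketTriple

/-- The two coefficients contribute $c^2$ and the derivative $1/c$, so the bracket transforms with
the factor $c$ of a vector field. -/
theorem IsWittRealization.changeVar {T : CKType} {G : Generators} (h : IsWittRealization T G)
    {c : ℂ} (hc : c ≠ 0) : IsWittRealization T (G.changeVar c) := by
  have hT := tendsto_const_mul_codiscrete (inv_ne_zero hc)
  have hm {f : ℂ → ℂ} (hf : Meromorphic f) : Meromorphic fun u => c * f (u / c) := by
    simp only [div_eq_inv_mul]
    exact (Meromorphic.const _).mul (meromorphic_comp_const_mul hf c⁻¹)
  have hbr (f g : ℂ → ℂ) (u : ℂ) : wittBracket (fun u => c * f (u / c)) (fun u => c * g (u / c)) u =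
      c * wittBracket f g (c⁻¹ * u) := by
    rw [wittBracket_const_mul]
    simp only [wittBracket, div_eq_inv_mul, deriv_comp_mul_left, smul_eq_mul]
    field_simp
  refine ⟨hm h.1, hm h.2, hm h.3, ?_, ?_, ?_, ?_⟩
  · filter_upwards [hT.eventually h.bracket_J_P₁] with u hu
    exact (hbr _ _ u).trans (by rw [hu, ← div_eq_inv_mul]; rfl)
  · filter_upwards [hT.eventually h.bracket_J_P₂] with u hu
    exact (hbr _ _ u).trans (by rw [hu, ← div_eq_inv_mul, mul_left_comm]; rfl)
  · filter_upwards [hT.eventually h.bracket_P₁_P₂] with u hu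
    exact (hbr _ _ u).trans (by rw [hu, ← div_eq_inv_mul, mul_left_comm]; rfl)
  · intro p q r h0
    refine h.independent p q r ?_
    filter_upwards [(tendsto_const_mul_codiscrete hc).eventually h0] with z hz
    simp only [Generators.changeVar, mul_div_cancel_left₀ _ hc] at hz
    exact (mul_eq_zero.1 (by linear_combination hz :
      c * (p * G.J z + q * G.P₁ z + r * G.P₂ z) = 0)).resolve_left hc

/-! ### Brackets of the Jacobi functions -/

section brackets

variable {k k' : ℂ}

theorem bracketTriple_basic (h : JacobiTriple (k ^ 2) (sn k) (cn k) (dn k)) :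
    BracketTriple (sn k) (cn k) (dn k) (-1) (1 - k ^ 2) 1 := by
  refine .of_hasDerivAt h.1 h.2 h.3 h.s_ne_zero h.c_ne_zero h.d_ne_zero ?_
  filter_upwards [h.deriv_s, h.deriv_c, h.deriv_d, h.sq_s_add_sq_c, h.sq_d_add_sq_s]
    with z h1 h2 h3 q1 q2
  refine ⟨_, _, _, h1, h2, h3, ?_, ?_, ?_⟩
  · linear_combination -dn k z * q1
  · linear_combination sn k z * (q2 - k ^ 2 * q1)
  · linear_combination cn k z * q2

/-- Since $[f/h,g/h]=[f,g]/h^2$, dividing $s,1,d$ by $h=c$ reduces everything to derivatives and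
brackets already known. The next two families arise likewise with $h=s$ and $h=d$. -/
theorem bracketTriple_c (h : JacobiTriple (k ^ 2) (sn k) (cn k) (dn k)) :
    BracketTriple (sc k) (nc k) (dc k) (-1) (-k ^ 2) 1 := by
  have Q := eventually_quotients k
  refine .of_hasDerivAt (meromorphic_regularize _) (meromorphic_regularize _)
    (meromorphic_regularize _) ?_ ?_ ?_ ?_
  · filter_upwards [Q, h.s_ne_zero, h.c_ne_zero] with z q n1 n2
    exact q.2.1.1 ▸ div_ne_zero n1 n2
  · filter_upwards [Q, h.c_ne_zero] with z q n2
    exact q.1.2.1 ▸ one_div_ne_zero n2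
  · filter_upwards [Q, h.d_ne_zero, h.c_ne_zero] with z q n1 n2
    exact q.2.2.2.2 ▸ div_ne_zero n1 n2
  filter_upwards [eventually_codiscrete_nhds Q, h.deriv_s, h.deriv_c, h.deriv_d, h.sq_s_add_sq_c,
    h.sq_d_add_sq_s, h.c_ne_zero] with z Q h1 h2 h3 q1 q2 n
  refine ⟨_, _, _, (h1.div h2 n).congr_of_eventuallyEq (Q.mono fun w q => q.2.1.1),
    ((hasDerivAt_const z (1 : ℂ)).div h2 n).congr_of_eventuallyEq (Q.mono fun w q => q.1.2.1),
    (h3.div h2 n).congr_of_eventuallyEq (Q.mono fun w q => q.2.2.2.2), ?_, ?_, ?_⟩ <;>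
  rw [Q.self_of_nhds.2.1.1, Q.self_of_nhds.1.2.1, Q.self_of_nhds.2.2.2.2] <;>
  generalize sn k z = s at * <;> generalize cn k z = c at * <;> generalize dn k z = d at * <;>
  field_simp
  · ring
  · ring
  · linear_combination c ^ 2 * q2

theorem bracketTriple_s (h : JacobiTriple (k ^ 2) (sn k) (cn k) (dn k)) :
    BracketTriple (ns k) (cs k) (ds k) (-1) (1 - k ^ 2) (k ^ 2) := by
  have Q := eventually_quotients k
  refine .of_hasDerivAt (meromorphic_regularize _) (meromorphic_regularize _)
    (meromorphic_regularize _) ?_ ?_ ?_ ?_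
  · filter_upwards [Q, h.s_ne_zero] with z q n2
    exact q.1.1 ▸ one_div_ne_zero n2
  · filter_upwards [Q, h.c_ne_zero, h.s_ne_zero] with z q n1 n2
    exact q.2.2.1 ▸ div_ne_zero n1 n2
  · filter_upwards [Q, h.d_ne_zero, h.s_ne_zero] with z q n1 n2
    exact q.2.2.2.1 ▸ div_ne_zero n1 n2
  filter_upwards [eventually_codiscrete_nhds Q, h.deriv_s, h.deriv_c, h.deriv_d, h.sq_s_add_sq_c,
    h.sq_d_add_sq_s, h.s_ne_zero] with z Q h1 h2 h3 q1 q2 n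
  refine ⟨_, _, _,
    ((hasDerivAt_const z (1 : ℂ)).div h1 n).congr_of_eventuallyEq (Q.mono fun w q => q.1.1),
    (h2.div h1 n).congr_of_eventuallyEq (Q.mono fun w q => q.2.2.1),
    (h3.div h1 n).congr_of_eventuallyEq (Q.mono fun w q => q.2.2.2.1), ?_, ?_, ?_⟩ <;>
  rw [Q.self_of_nhds.1.1, Q.self_of_nhds.2.2.1, Q.self_of_nhds.2.2.2.1] <;>
  generalize sn k z = s at * <;> generalize cn k z = c at * <;> generalize dn k z = d at * <;>
  field_simp
  · ring
  · linear_combination s ^ 2 * (q2 - k ^ 2 * q1)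
  · ring

theorem bracketTriple_d (h : JacobiTriple (k ^ 2) (sn k) (cn k) (dn k)) :
    BracketTriple (sd k) (cd k) (nd k) (-1) 1 1 := by
  have Q := eventually_quotients k
  refine .of_hasDerivAt (meromorphic_regularize _) (meromorphic_regularize _)
    (meromorphic_regularize _) ?_ ?_ ?_ ?_
  · filter_upwards [Q, h.s_ne_zero, h.d_ne_zero] with z q n1 n2
    exact q.2.1.2.1 ▸ div_ne_zero n1 n2
  · filter_upwards [Q, h.c_ne_zero, h.d_ne_zero] with z q n1 n2
    exact q.2.1.2.2 ▸ div_ne_zero n1 n2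
  · filter_upwards [Q, h.d_ne_zero] with z q n2
    exact q.1.2.2 ▸ one_div_ne_zero n2
  filter_upwards [eventually_codiscrete_nhds Q, h.deriv_s, h.deriv_c, h.deriv_d, h.sq_s_add_sq_c,
    h.sq_d_add_sq_s, h.d_ne_zero] with z Q h1 h2 h3 q1 q2 n
  refine ⟨_, _, _, (h1.div h3 n).congr_of_eventuallyEq (Q.mono fun w q => q.2.1.2.1),
    (h2.div h3 n).congr_of_eventuallyEq (Q.mono fun w q => q.2.1.2.2),
    ((hasDerivAt_const z (1 : ℂ)).div h3 n).congr_of_eventuallyEq (Q.mono fun w q => q.1.2.2),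
    ?_, ?_, ?_⟩ <;>
  rw [Q.self_of_nhds.2.1.2.1, Q.self_of_nhds.2.1.2.2, Q.self_of_nhds.1.2.2] <;>
  generalize sn k z = s at * <;> generalize cn k z = c at * <;> generalize dn k z = d at * <;>
  field_simp
  · linear_combination -d ^ 2 * q1
  · ring
  · ring

theorem isWittRealization_basicFamily (h : JacobiTriple (k ^ 2) (sn k) (cn k) (dn k))
    (hk' : k' ≠ 0) (hq : k ^ 2 + k' ^ 2 = 1) (T : CKType) :
    IsWittRealization T (basicFamily k k' T) := by
  have b := bracketTriple_basic h
  rw [show 1 - k ^ 2 = k' ^ 2 by linear_combination -hq] at b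
  have hI := I_sq
  have hI0 := I_ne_zero
  cases T
  -- The order becomes $(\mathrm{dn},\mathrm{cn},\mathrm{sn})$ with constants $-k'^2,1,-1$; the
  -- scalars are the coefficients in the family. The other cases and families follow the same
  -- pattern.
  · refine b.rotate.swap.isWittRealization _ (α := -1 / k') (β := I / k') (γ := I)
      ?_ ?_ ?_ ?_ ?_ ?_ ?_ ?_ ?_
    all_goals try simp only [CKType.curv1, CKType.curv2, basicFamily]
    all_goals grind
  · refine b.rotate.swap.isWittRealization _ (α := -1 / k') (β := 1 / k') (γ := 1)
      ?_ ?_ ?_ ?_ ?_ ?_ ?_ ?_ ?_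
    all_goals try simp only [CKType.curv1, CKType.curv2, basicFamily]
    all_goals grind
  · refine b.rotate.isWittRealization _ (α := 1 / k') (β := 1 / k') (γ := 1)
      ?_ ?_ ?_ ?_ ?_ ?_ ?_ ?_ ?_
    all_goals try simp only [CKType.curv1, CKType.curv2, basicFamily]
    all_goals grind
  · refine b.rotate.rotate.swap.isWittRealization _ (α := 1) (β := -I / k') (γ := I / k')
      ?_ ?_ ?_ ?_ ?_ ?_ ?_ ?_ ?_
    all_goals try simp only [CKType.curv1, CKType.curv2, basicFamily]
    all_goals grind

theorem isWittRealization_cFamily (h : JacobiTriple (k ^ 2) (sn k) (cn k) (dn k))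
    (hk : k ≠ 0) (T : CKType) : IsWittRealization T (cFamily k T) := by
  have b := bracketTriple_c h
  have hI := I_sq
  have hI0 := I_ne_zero
  cases T
  · refine b.rotate.swap.isWittRealization _ (α := I / k) (β := 1 / k) (γ := I)
      ?_ ?_ ?_ ?_ ?_ ?_ ?_ ?_ ?_
    all_goals try simp only [CKType.curv1, CKType.curv2, cFamily]
    all_goals grind
  · refine b.rotate.rotate.isWittRealization _ (α := I / k) (β := -1) (γ := -I / k)
      ?_ ?_ ?_ ?_ ?_ ?_ ?_ ?_ ?_
    all_goals try simp only [CKType.curv1, CKType.curv2, cFamily]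
    all_goals grind
  · refine b.rotate.swap.isWittRealization _ (α := 1 / k) (β := 1 / k) (γ := 1)
      ?_ ?_ ?_ ?_ ?_ ?_ ?_ ?_ ?_
    all_goals try simp only [CKType.curv1, CKType.curv2, cFamily]
    all_goals grind
  · refine b.rotate.swap.isWittRealization _ (α := 1 / k) (β := I / k) (γ := I)
      ?_ ?_ ?_ ?_ ?_ ?_ ?_ ?_ ?_
    all_goals try simp only [CKType.curv1, CKType.curv2, cFamily]
    all_goals grind

theorem isWittRealization_sFamily (h : JacobiTriple (k ^ 2) (sn k) (cn k) (dn k))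
    (hk : k ≠ 0) (hk' : k' ≠ 0) (hq : k ^ 2 + k' ^ 2 = 1) (T : CKType) :
    IsWittRealization T (sFamily k k' T) := by
  have b := bracketTriple_s h
  rw [show 1 - k ^ 2 = k' ^ 2 by linear_combination -hq] at b
  have hI := I_sq
  have hI0 := I_ne_zero
  cases T
  · refine b.isWittRealization _ (α := I / k) (β := I / k') (γ := 1 / (k * k'))
      ?_ ?_ ?_ ?_ ?_ ?_ ?_ ?_ ?_
    all_goals try simp only [CKType.curv1, CKType.curv2, sFamily]
    all_goals grind
  · refine b.rotate.rotate.isWittRealization _ (α := 1 / (k * k')) (β := 1 / k) (γ := 1 / k')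
      ?_ ?_ ?_ ?_ ?_ ?_ ?_ ?_ ?_
    all_goals try simp only [CKType.curv1, CKType.curv2, sFamily]
    all_goals grind
  · refine b.rotate.isWittRealization _ (α := 1 / k') (β := 1 / (k * k')) (γ := 1 / k)
      ?_ ?_ ?_ ?_ ?_ ?_ ?_ ?_ ?_
    all_goals try simp only [CKType.curv1, CKType.curv2, sFamily]
    all_goals grind
  · refine b.isWittRealization _ (α := 1 / k) (β := 1 / k') (γ := -1 / (k * k'))
      ?_ ?_ ?_ ?_ ?_ ?_ ?_ ?_ ?_
    all_goals try simp only [CKType.curv1, CKType.curv2, sFamily]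
    all_goals grind

theorem isWittRealization_dFamily (h : JacobiTriple (k ^ 2) (sn k) (cn k) (dn k))
    (T : CKType) : IsWittRealization T (dFamily k T) := by
  have b := bracketTriple_d h
  have hI := I_sq
  have hI0 := I_ne_zero
  cases T
  · refine b.rotate.swap.isWittRealization _ (α := -1) (β := I) (γ := I)
      ?_ ?_ ?_ ?_ ?_ ?_ ?_ ?_ ?_
    all_goals try simp only [CKType.curv1, CKType.curv2, dFamily]
    all_goals grind
  · refine b.rotate.rotate.isWittRealization _ (α := 1) (β := 1) (γ := 1)
      ?_ ?_ ?_ ?_ ?_ ?_ ?_ ?_ ?_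
    all_goals try simp only [CKType.curv1, CKType.curv2, dFamily]
    all_goals grind
  · refine b.rotate.rotate.isWittRealization _ (α := I) (β := I) (γ := -1)
      ?_ ?_ ?_ ?_ ?_ ?_ ?_ ?_ ?_
    all_goals try simp only [CKType.curv1, CKType.curv2, dFamily]
    all_goals grind
  · refine b.rotate.rotate.swap.isWittRealization _ (α := 1) (β := -I) (γ := I)
      ?_ ?_ ?_ ?_ ?_ ?_ ?_ ?_ ?_
    all_goals try simp only [CKType.curv1, CKType.curv2, dFamily]
    all_goals grind

end brackets

/-! ### Real moduli -/

theorem cFamily_elliptic_changeVar_I {τ k k' : ℂ} (hτ : 0 < τ.im) (hk : k = modulus τ)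
    (hk' : k' = comodulus τ) : (cFamily k' .elliptic).changeVar I =
      ⟨fun ζ => -(1 / k') * dn k ζ, fun ζ => I * (1 / k') * cn k ζ, fun ζ => I * sn k ζ⟩ := by
  have key (ζ : ℂ) := jacobi_imaginary hτ hk hk' (ζ / I)
  simp only [mul_div_cancel₀ _ I_ne_zero] at key
  simp only [Generators.changeVar, cFamily, Generators.mk.injEq]
  refine ⟨funext fun ζ => ?_, funext fun ζ => ?_, funext fun ζ => ?_⟩
  · rw [(key ζ).2.2.1]
    linear_combination (dn k ζ / k') * I_sq
  · rw [(key ζ).2.1]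
    ring
  · rw [(key ζ).1]
    linear_combination (-I * sn k ζ) * I_sq

theorem dFamily_changeVar_comodulus {τ k k' : ℂ} (hτ : 0 < τ.im) (hk : k = modulus τ)
    (hk' : k' = comodulus τ) (T : CKType) :
    (dFamily k T).changeVar k' = lambdaFamily (I * k / k') k' T := by
  have hk0 : k' ≠ 0 := hk' ▸ comodulus_ne_zero hτ
  have key (u : ℂ) := jacobi_translate hτ hk hk' rfl (u / k')
  simp only [mul_div_cancel₀ _ hk0] at key
  cases T <;>
  · simp only [Generators.changeVar, dFamily, lambdaFamily, Generators.mk.injEq]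
    refine ⟨funext fun u => ?_, funext fun u => ?_, funext fun u => ?_⟩ <;>
    · simp only [(key u).1, (key u).2.1, (key u).2.2]
      try field_simp

theorem image_norm_lambda :
    (fun k : ℝ => ‖I * (k : ℂ) / ((√(1 - k ^ 2) : ℝ) : ℂ)‖) '' Set.Ioo 0 1 = Set.Ioi 0 := by
  ext x
  simp only [Set.mem_image, Set.mem_Ioo, Set.mem_Ioi, norm_div, norm_mul, norm_I, one_mul,
    norm_real, Real.norm_eq_abs, abs_of_nonneg (Real.sqrt_nonneg _)]
  constructor
  · rintro ⟨k, ⟨h0, h1⟩, rfl⟩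
    exact div_pos (abs_pos.2 h0.ne') (Real.sqrt_pos.2 (by nlinarith))
  · intro hx
    have h1 : 0 < 1 + x ^ 2 := by positivity
    have hs : 0 < √(1 + x ^ 2) := Real.sqrt_pos.2 h1
    have hsq : √(1 + x ^ 2) ^ 2 = 1 + x ^ 2 := Real.sq_sqrt h1.le
    -- The solution $k$ of $k/\sqrt{1-k^2}=x$.
    refine ⟨x / √(1 + x ^ 2), ⟨div_pos hx hs, (div_lt_one hs).2 (Real.lt_sqrt_of_sq_lt ?_)⟩, ?_⟩
    · linarith
    · rw [abs_of_pos (div_pos hx hs), show 1 - (x / √(1 + x ^ 2)) ^ 2 = (1 / √(1 + x ^ 2)) ^ 2 by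
        field_simp
        linarith, Real.sqrt_sq (by positivity)]
      field_simp

end JacobiElliptic

theorem mainTheorem3 :
    -- the Jacobi functions depend on `τ` only through the modulus
    (∀ τ : ℂ, 0 < τ.im →
      sn (modulus τ) = snTau τ ∧ cn (modulus τ) = cnTau τ ∧ dn (modulus τ) = dnTau τ) ∧
    -- every `k ∈ (0, 1)` is a modulus, with complementary modulus `√(1 - k²)`
    (∀ k : ℝ, 0 < k → k < 1 → ∃ t : ℝ, 0 < t ∧
      modulus (I * (t : ℂ)) = (k : ℂ) ∧ comodulus (I * (t : ℂ)) = ((√(1 - k ^ 2) : ℝ) : ℂ)) ∧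
    -- the transformation `τ ↦ -1/τ`
    (∀ τ k k' : ℂ, 0 < τ.im → k = modulus τ → k' = comodulus τ →
      modulus (-1 / τ) = k' ∧ comodulus (-1 / τ) = k ∧
      ∀ z : ℂ,
        sc k' z = -I * sn k (I * z) ∧ nc k' z = cn k (I * z) ∧ dc k' z = dn k (I * z) ∧
        cs k' z = I * ns k (I * z) ∧ ds k' z = I * ds k (I * z) ∧ ns k' z = I * cs k (I * z) ∧
        nd k' z = cd k (I * z) ∧ cd k' z = nd k (I * z) ∧ sd k' z = -I * sd k (I * z) ∧
        cn k' z = nc k (I * z) ∧ sn k' z = -I * sc k (I * z) ∧ dn k' z = dc k (I * z)) ∧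
    -- the transformation `τ ↦ τ + 1`
    (∀ τ k k' l : ℂ, 0 < τ.im → k = modulus τ → k' = comodulus τ → l = I * k / k' →
      k ^ 2 + k' ^ 2 = 1 ∧ k ≠ 0 ∧ k' ≠ 0 ∧
      modulus (τ + 1) = l ∧ comodulus (τ + 1) = 1 / k' ∧
      ∀ z : ℂ,
        sd k z = sn l (k' * z) / k' ∧ cd k z = cn l (k' * z) ∧ nd k z = dn l (k' * z)) ∧
    -- realizations with modulus `k'`, in the variable `z` and in the variable `ζ = iz`
    (∀ k k' : ℝ, 0 < k → k < 1 → k' = √(1 - k ^ 2) →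
      (∀ T : CKType,
        IsWittRealization T (basicFamily k' k T) ∧
        IsWittRealization T (cFamily k' T) ∧
        IsWittRealization T (sFamily k' k T) ∧
        IsWittRealization T (dFamily k' T) ∧
        IsWittRealization T ((basicFamily k' k T).changeVar I) ∧
        IsWittRealization T ((cFamily k' T).changeVar I) ∧
        IsWittRealization T ((sFamily k' k T).changeVar I) ∧
        IsWittRealization T ((dFamily k' T).changeVar I)) ∧
      (cFamily k' .elliptic).changeVar I =
        ⟨fun ζ => -(1 / (k' : ℂ)) * dn k ζ, fun ζ => I * (1 / (k' : ℂ)) * cn k ζ,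
          fun ζ => I * sn k ζ⟩) ∧
    -- realizations with modulus `λ = ik/k'`, in the variable `u = k'z`
    (∀ k k' : ℝ, 0 < k → k < 1 → k' = √(1 - k ^ 2) → ∀ T : CKType,
      (dFamily k T).changeVar k' = lambdaFamily (I * k / k') k' T ∧
      IsWittRealization T (lambdaFamily (I * k / k') k' T)) ∧
    -- the absolute values of these moduli `λ` fill `(0, ∞)`
    (fun k : ℝ => ‖I * (k : ℂ) / ((√(1 - k ^ 2) : ℝ) : ℂ)‖) '' Set.Ioo 0 1 = Set.Ioi 0 := by
  refine ⟨fun τ hτ => jacobi_modulus_eq_tau hτ, fun k h0 h1 => exists_modulus_I_mul_eq h0 h1,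
    ?_, ?_, ?_, ?_, image_norm_lambda⟩
  · intro τ k k' hτ hk hk'
    exact ⟨hk' ▸ modulus_neg_one_div_eq_comodulus hτ, hk ▸ comodulus_neg_one_div hτ,
      jacobi_imaginary hτ hk hk'⟩
  · intro τ k k' l hτ hk hk' hl
    refine ⟨?_, ?_, ?_, ?_, ?_, jacobi_translate hτ hk hk' hl⟩
    · rw [hk, hk', sq_add_sq_modulus hτ]
    · exact hk ▸ modulus_ne_zero hτ
    · exact hk' ▸ comodulus_ne_zero hτ
    · rw [hl, hk, hk', (modulus_add_one hτ).1]
    · rw [hk', (modulus_add_one hτ).2]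
  · rintro k k' h0 h1 rfl
    obtain ⟨t, ht, hk, hk'⟩ := exists_modulus_I_mul_eq h0 h1
    have hτ : 0 < (I * (t : ℂ)).im := by simpa using ht
    -- The functions have modulus $k'$, so the roles of $k$ and $k'$ in the families are exchanged.
    have h := jacobiTriple_comodulus hτ
    have hq := sq_add_sq_modulus hτ
    have hk0 := modulus_ne_zero hτ
    have hk0' := comodulus_ne_zero hτ
    rw [hk, hk'] at hq
    rw [hk] at hk0
    rw [hk'] at h hk0'
    rw [add_comm] at hq
    refine ⟨fun T => ?_, cFamily_elliptic_changeVar_I hτ hk.symm hk'.symm⟩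
    have hb := isWittRealization_basicFamily h hk0 hq T
    have hc := isWittRealization_cFamily h hk0' T
    have hs := isWittRealization_sFamily h hk0' hk0 hq T
    have hd := isWittRealization_dFamily h T
    exact ⟨hb, hc, hs, hd, hb.changeVar I_ne_zero, hc.changeVar I_ne_zero,
      hs.changeVar I_ne_zero, hd.changeVar I_ne_zero⟩
  · rintro k k' h0 h1 rfl T
    obtain ⟨t, ht, hk, hk'⟩ := exists_modulus_I_mul_eq h0 h1
    have hτ : 0 < (I * (t : ℂ)).im := by simpa using ht
    have h := jacobiTriple_modulus hτ
    have hk0' := comodulus_ne_zero hτ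
    rw [hk] at h
    rw [hk'] at hk0'
    have e := dFamily_changeVar_comodulus hτ hk.symm hk'.symm T
    exact ⟨e, e ▸ (isWittRealization_dFamily h T).changeVar hk0'⟩
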